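/- Let $(R,\mathfrak{m},k)$ be a commutative noetherian local ring and let $n\ge 0$ be an integer. A finitely generated module $G$ over a commutative noetherian ring $A$ is called totally reflexive if the biduality map $G\to G^{**}$ is an isomorphism and $\operatorname{Ext}_A^i(G,A)=0=\operatorname{Ext}_A^i(G^*,A)$ for all $i>0$, where $(-)^*=\operatorname{Hom}_A(-,A)$. The G-dimension of a nonzero finitely generated $A$-module $M$ is the least integer $d\ge 0$ for which there is an exact sequence $0\to G_d\to\cdots\to G_0\to M\to 0$ with every $G_i$ totally reflexive, and $\infty$ if no such $d$ exists; the zero module has G-dimension $-\infty$. Say that a commutative noetherian local ring $A$ has the property (TG) if every finitely generated $A$-module $M$ satisfying $\operatorname{Tor}^A_i(M,M)=0$ for all $i\gg 0$ has G-dimension $<\infty$. Then the following conditions are equivalent: 1. $R$ has the property (TG). 2. The $\mathfrak{m}$-adic completion $\widehat{R}$ has the property (TG). 3. The power series ring $R[[X_1,\ldots,X_n]]$ has the property (TG). 4. The localized polynomial ring $R[X_1,\ldots,X_n]_{(\mathfrak{m},X_1,\ldots,X_n)}$ has the property (TG). -/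

import Mathlib

open CategoryTheory

universe u

noncomputable section

namespace TorGDim

/-- A module `G` over a commutative (noetherian) ring `R` belongs to Auslander's G-class of `R`
(it is totally reflexive) if it is finitely generated, the biduality map `G → G**` is an
isomorphism, and `Ext^i_R(G, R) = 0 = Ext^i_R(G*, R)` for all `i > 0`, where
`G* = Hom_R(G, R)`. -/
structure IsTotallyReflexive (R : Type u) [CommRing R]
    (G : Type u) [AddCommGroup G] [Module R G] : Prop where
  finite : Module.Finite R G
  bijective_dual_eval : Function.Bijective (Module.Dual.eval R G)
  ext_eq_zero : ∀ i : ℕ, 0 < i →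
    Subsingleton (Abelian.Ext (ModuleCat.of R G) (ModuleCat.of R R) i)
  ext_dual_eq_zero : ∀ i : ℕ, 0 < i →
    Subsingleton (Abelian.Ext (ModuleCat.of R (Module.Dual R G)) (ModuleCat.of R R) i)

/-- A G-resolution of `M` of length at most `n`: an exact sequence
`⋯ → G 2 → G 1 → G 0 → M → 0` of `R`-modules, in which all `G i` are totally reflexive
and `G i = 0` for all `i > n`. -/
structure GResolution (R : Type u) [CommRing R]
    (M : Type u) [AddCommGroup M] [Module R M] (n : ℕ) where
  /-- the modules of the resolution -/
  G : ℕ → ModuleCat.{u} R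
  /-- the differentials -/
  d : ∀ i : ℕ, G (i + 1) →ₗ[R] G i
  /-- the augmentation -/
  aug : G 0 →ₗ[R] M
  isTotallyReflexive : ∀ i : ℕ, IsTotallyReflexive R (G i)
  subsingleton : ∀ i : ℕ, n < i → Subsingleton (G i)
  surjective_aug : Function.Surjective aug
  exact_zero : Function.Exact (d 0) aug
  exact_succ : ∀ i : ℕ, Function.Exact (d (i + 1)) (d i)

open Classical in
/-- The G-dimension of a (finitely generated) module `M`: the least `n` such that `M` has a
G-resolution of length at most `n`, and `⊤` (that is, `∞`) if there is none; by convention the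
zero module has G-dimension `⊥` (that is, `-∞`). -/
def gDim (R : Type u) [CommRing R] (M : Type u) [AddCommGroup M] [Module R M] : WithBot ℕ∞ :=
  if Subsingleton M then ⊥
  else sInf {x : WithBot ℕ∞ | ∃ n : ℕ, x = (n : WithBot ℕ∞) ∧ Nonempty (GResolution R M n)}

/-- `Tor^R_i(M, M) = 0` for all `i ≫ 0`. -/
def HasBoundedSelfTor (R : Type u) [CommRing R] (M : Type u) [AddCommGroup M] [Module R M] :
    Prop :=
  ∃ N : ℕ, ∀ i : ℕ, N ≤ i →
    Limits.IsZero (((Tor (ModuleCat.{u} R) i).obj (ModuleCat.of R M)).obj (ModuleCat.of R M))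

/-- The property (TG) of a commutative noetherian local ring `R`: every finitely generated
`R`-module `M` with `Tor^R_i(M, M) = 0` for all `i ≫ 0` has finite G-dimension. -/
def HasTG (R : Type u) [CommRing R] : Prop :=
  ∀ (M : Type u) [AddCommGroup M] [Module R M], Module.Finite R M →
    HasBoundedSelfTor R M → gDim R M < ⊤

/-- The ideal `(𝔪, X_1, …, X_n)` of `R[X_1, …, X_n]`, where `𝔪` is the maximal ideal of the
local ring `R`. -/
def maxIdealX (R : Type u) [CommRing R] [IsLocalRing R] (n : ℕ) :
    Ideal (MvPolynomial (Fin n) R) :=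
  (IsLocalRing.maximalIdeal R).map (MvPolynomial.C : R →+* MvPolynomial (Fin n) R) ⊔
    Ideal.span (Set.range (MvPolynomial.X : Fin n → MvPolynomial (Fin n) R))

theorem maxIdealX_eq_comap (R : Type u) [CommRing R] [IsLocalRing R] (n : ℕ) :
    maxIdealX R n = (IsLocalRing.maximalIdeal R).comap
      (MvPolynomial.constantCoeff : MvPolynomial (Fin n) R →+* R) := by
  apply le_antisymm
  · refine sup_le ?_ ?_
    · rw [Ideal.map_le_iff_le_comap]
      intro r hr
      simpa [Ideal.mem_comap] using hr
    · rw [Ideal.span_le]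
      rintro _ ⟨i, rfl⟩
      simp
  · intro p hp
    have h1 : p - MvPolynomial.C (MvPolynomial.constantCoeff p) ∈
        Ideal.span (Set.range (MvPolynomial.X : Fin n → MvPolynomial (Fin n) R)) := by
      rw [← Set.image_univ, MvPolynomial.mem_ideal_span_X_image]
      intro m hm
      by_contra! hcon
      have : m = 0 := by
        ext i
        exact hcon i (Set.mem_univ i)
      subst this
      simp [MvPolynomial.constantCoeff_eq] at hm
    have h2 : MvPolynomial.C (MvPolynomial.constantCoeff p) ∈
        (IsLocalRing.maximalIdeal R).map (MvPolynomial.C : R →+* MvPolynomial (Fin n) R) :=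
      Ideal.mem_map_of_mem _ hp
    have h3 : MvPolynomial.C (MvPolynomial.constantCoeff p) +
        (p - MvPolynomial.C (MvPolynomial.constantCoeff p)) ∈ maxIdealX R n :=
      Submodule.add_mem_sup h2 h1
    rwa [add_sub_cancel] at h3

instance maxIdealX_isPrime (R : Type u) [CommRing R] [IsLocalRing R] (n : ℕ) :
    (maxIdealX R n).IsPrime := by
  rw [maxIdealX_eq_comap]
  infer_instance

end TorGDim

end

/-!
The property (TG) is compared along two kinds of ring homomorphism.

* If `S → T` is faithfully flat and `T` has (TG), then so does `S` (`HasTG.of_faithfullyFlat`):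
  vanishing of `Tor` ascends to `T`, and finiteness of the G-dimension descends, since it says that
  some syzygy is totally reflexive, a condition on biduality and `Ext` that is detected by `T ⊗ -`.
* If `T = S / (x)` for a regular element `x` of the Jacobson radical, then `S` has (TG) if and only
  if `T` has it. For `HasTG.of_isQuotientBy`, a first syzygy `K` of an `S`-module with bounded
  self-`Tor` has `x` regular, so `K / xK` has bounded self-`Tor` over `T`, and finiteness of the
  G-dimension lifts from `K / xK` to `K`. For `HasTG.isQuotientBy`, a `T`-module `M` with bounded
  self-`Tor` over `T` has bounded self-`Tor` over `S`, by the four-term exact sequence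
  `0 → M → T ⊗ K → T ⊗ F → M → 0` of a free cover `0 → K → F → M → 0` over `S`. Conversely to the
  lifting, finite G-dimension over `S` gives finite G-dimension over `T`: each syzygy over `T`
  lowers the G-dimension over `S` by one as long as it exceeds `1`, and a `T`-module of
  G-dimension at most `1` over `S` is totally reflexive over `T`
  (`IsQuotientBy.isTotallyReflexive_of_gDimLE_one`). Here `x` need not lie in the radical.

Since `B = B⟦X⟧ / (X)`, the rings `R` and `R⟦X₁, …, Xₙ⟧` have (TG) simultaneously. The localized
polynomial ring sits between them, and both `R → R[X₁, …, Xₙ]_(𝔪, X)` and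
`R[X₁, …, Xₙ]_(𝔪, X) → R⟦X₁, …, Xₙ⟧` are faithfully flat.

For the completion, `R → R̂` is faithfully flat, so (TG) descends. It ascends because `R̂` arises
from `R` by finitely many steps `T ↦ T⟦X⟧ / (X - a)`, one for each `a` in a list of generators of
`𝔪` (`PowerSeriesQuotient`). Each step consists of one extension to power series and one quotient by
an element, which is regular by Krull's intersection theorem. None of the steps changes `R` modulo
powers of `𝔪`, and the last ring, as a quotient of `R⟦X₁, …, Xᵣ⟧` in which the variables generate
the extension of `𝔪`, is complete; therefore it is `R̂` (`PowerSeriesQuotient.nonempty_ringEquiv`).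
-/

open TensorProduct

noncomputable section

namespace TorGDim

/-! ### Short exact sequences and vanishing of `Ext(-, R)` -/

/-- The sequence `0 → A → B → C → 0` given by `f` and `g` is exact. -/
structure IsShortExact {R : Type*} [CommRing R] {A B C : Type*} [AddCommGroup A] [Module R A]
    [AddCommGroup B] [Module R B] [AddCommGroup C] [Module R C]
    (f : A →ₗ[R] B) (g : B →ₗ[R] C) : Prop where
  inj : Function.Injective f
  exact : Function.Exact f g
  surj : Function.Surjective g

section ShortExact

variable {R : Type*} [CommRing R] {A B C : Type*} [AddCommGroup A] [Module R A]
    [AddCommGroup B] [Module R B] [AddCommGroup C] [Module R C]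

theorem isShortExact_ker_subtype {g : B →ₗ[R] C} (hg : Function.Surjective g) :
    IsShortExact (LinearMap.ker g).subtype g :=
  ⟨Subtype.val_injective, g.exact_subtype_ker_map, hg⟩

theorem IsShortExact.map_eq_zero {f : A →ₗ[R] B} {g : B →ₗ[R] C} (h : IsShortExact f g) (a : A) :
    g (f a) = 0 :=
  h.exact.apply_apply_eq_zero a

theorem IsShortExact.exists_eq {f : A →ₗ[R] B} {g : B →ₗ[R] C} (h : IsShortExact f g) {b : B}
    (hb : g b = 0) : ∃ a, f a = b :=
  (h.exact b).1 hb

/-- A map on the middle term that kills the left term descends to the right term. -/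
theorem IsShortExact.exists_desc {f : A →ₗ[R] B} {g : B →ₗ[R] C} (h : IsShortExact f g)
    {D : Type*} [AddCommGroup D] [Module R D] (φ : B →ₗ[R] D) (hφ : ∀ a, φ (f a) = 0) :
    ∃ ψ : C →ₗ[R] D, ∀ b, ψ (g b) = φ b := by
  have hker : LinearMap.ker g ≤ LinearMap.ker φ := by
    intro b hb
    obtain ⟨a, rfl⟩ := h.exists_eq hb
    exact hφ a
  refine ⟨((LinearMap.ker g).liftQ φ hker).comp
    (g.quotKerEquivOfSurjective h.surj).symm.toLinearMap, fun b => ?_⟩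
  have : (g.quotKerEquivOfSurjective h.surj).symm (g b) = Submodule.Quotient.mk b := by
    rw [LinearEquiv.symm_apply_eq]
    rfl
  simp [this]

theorem isShortExact_of_equiv (e : A ≃ₗ[R] B) :
    IsShortExact e.toLinearMap (0 : B →ₗ[R] PUnit.{u + 1}) :=
  ⟨e.injective, fun b => ⟨fun _ => ⟨e.symm b, by simp⟩, fun _ => rfl⟩,
    fun _ => ⟨0, Subsingleton.elim _ _⟩⟩

theorem IsShortExact.finite_left [IsNoetherianRing R] [Module.Finite R B] {f : A →ₗ[R] B}
    {g : B →ₗ[R] C} (h : IsShortExact f g) : Module.Finite R A :=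
  Module.Finite.of_injective f h.inj

end ShortExact

/-- Every finitely generated module over a noetherian ring has a presentation by a finitely
generated free module, in the same universe. -/
theorem exists_free_cover (R : Type u) [CommRing R] (M : Type u) [AddCommGroup M] [Module R M]
    [Module.Finite R M] : ∃ (n : ℕ) (g : (Fin n → R) →ₗ[R] M), Function.Surjective g :=
  Module.Finite.exists_fin' R M

section Ext

variable {R : Type u} [CommRing R]

/-- `Ext^i_R(G, R) = 0` for all `i > 0`. -/
def ExtVanish (R : Type u) [CommRing R] (G : Type u) [AddCommGroup G] [Module R G] : Prop :=
  ∀ i : ℕ, 0 < i → Subsingleton (Abelian.Ext (ModuleCat.of R G) (ModuleCat.of R R) i)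

variable {A B C : Type u} [AddCommGroup A] [Module R A]
    [AddCommGroup B] [Module R B] [AddCommGroup C] [Module R C]

/-- The short complex of modules underlying a short exact sequence. -/
abbrev IsShortExact.sc {f : A →ₗ[R] B} {g : B →ₗ[R] C} (h : IsShortExact f g) :
    ShortComplex (ModuleCat.{u} R) :=
  ShortComplex.moduleCatMk f g h.exact.linearMap_comp_eq_zero

theorem IsShortExact.shortExact {f : A →ₗ[R] B} {g : B →ₗ[R] C} (h : IsShortExact f g) :
    h.sc.ShortExact where
  exact := by
    rw [ShortComplex.moduleCat_exact_iff]
    intro x hx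
    exact h.exists_eq hx
  mono_f := (ModuleCat.mono_iff_injective _).2 h.inj
  epi_g := (ModuleCat.epi_iff_surjective _).2 h.surj

theorem ExtVanish.of_projective [Module.Projective R A] : ExtVanish R A := by
  intro i hi
  obtain ⟨i, rfl⟩ := Nat.exists_eq_succ_of_ne_zero hi.ne'
  have : Projective (ModuleCat.of R A) := (IsProjective.iff_projective A).1 inferInstance
  exact ⟨fun a b => by rw [Abelian.Ext.eq_zero_of_projective a, Abelian.Ext.eq_zero_of_projective b]⟩

theorem ExtVanish.left {f : A →ₗ[R] B} {g : B →ₗ[R] C} (h : IsShortExact f g)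
    (hB : ExtVanish R B) (hC : ExtVanish R C) : ExtVanish R A := by
  intro i hi
  refine subsingleton_of_forall_eq 0 fun a => ?_
  have : Subsingleton (Abelian.Ext h.sc.X₃ (ModuleCat.of R R) (1 + i)) := hC (1 + i) (by omega)
  have : Subsingleton (Abelian.Ext h.sc.X₂ (ModuleCat.of R R) i) := hB i hi
  obtain ⟨b, rfl⟩ := Abelian.Ext.contravariant_sequence_exact₁ h.shortExact (ModuleCat.of R R) a rfl
    (Subsingleton.elim _ _)
  rw [Subsingleton.elim b 0]
  exact Abelian.Ext.comp_zero ..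

theorem ExtVanish.middle {f : A →ₗ[R] B} {g : B →ₗ[R] C} (h : IsShortExact f g)
    (hA : ExtVanish R A) (hC : ExtVanish R C) : ExtVanish R B := by
  intro i hi
  refine subsingleton_of_forall_eq 0 fun b => ?_
  have : Subsingleton (Abelian.Ext h.sc.X₃ (ModuleCat.of R R) i) := hC i hi
  have : Subsingleton (Abelian.Ext h.sc.X₁ (ModuleCat.of R R) i) := hA i hi
  obtain ⟨c, rfl⟩ := Abelian.Ext.contravariant_sequence_exact₂ h.shortExact (ModuleCat.of R R) b
    (Subsingleton.elim _ _)
  rw [Subsingleton.elim c 0]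
  exact Abelian.Ext.comp_zero ..

/-- One step of dimension shifting: `Ext^1(C, R)` is the cokernel of `B* → A*` and
`Ext^(i+1)(C, R)` is `Ext^i(A, R)`, as soon as the positive `Ext(B, R)` vanish. -/
theorem subsingleton_ext_of_isShortExact {f : A →ₗ[R] B} {g : B →ₗ[R] C} (h : IsShortExact f g)
    (hB : ExtVanish R B) (hext : ∀ φ : A →ₗ[R] R, ∃ ψ : B →ₗ[R] R, ∀ a, ψ (f a) = φ a) (i : ℕ)
    (hA : 0 < i → Subsingleton (Abelian.Ext (ModuleCat.of R A) (ModuleCat.of R R) i)) :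
    Subsingleton (Abelian.Ext (ModuleCat.of R C) (ModuleCat.of R R) (i + 1)) := by
  refine subsingleton_of_forall_eq 0 fun c => ?_
  have : Subsingleton (Abelian.Ext h.sc.X₂ (ModuleCat.of R R) (i + 1)) := hB (i + 1) (by omega)
  obtain ⟨a, rfl⟩ := Abelian.Ext.contravariant_sequence_exact₃ h.shortExact (ModuleCat.of R R) c
    (Subsingleton.elim _ _)
    (add_comm 1 i)
  rcases Nat.eq_zero_or_pos i with rfl | hi
  · obtain ⟨φ, rfl⟩ := (Abelian.Ext.mk₀_bijective _ _).2 a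
    obtain ⟨ψ, hψ⟩ := hext φ.hom
    obtain ⟨χ, rfl⟩ : ∃ χ : h.sc.X₂ ⟶ ModuleCat.of R R, φ = h.sc.f ≫ χ := by
      refine ⟨ModuleCat.ofHom ψ, ?_⟩
      ext x
      exact (hψ x).symm
    rw [← Abelian.Ext.mk₀_comp_mk₀]
    exact h.shortExact.extClass_comp_assoc _
  · have : Subsingleton (Abelian.Ext h.sc.X₁ (ModuleCat.of R R) i) := hA hi
    rw [Subsingleton.elim a 0]
    exact Abelian.Ext.comp_zero ..

theorem ExtVanish.right {f : A →ₗ[R] B} {g : B →ₗ[R] C} (h : IsShortExact f g)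
    (hA : ExtVanish R A) (hB : ExtVanish R B)
    (hext : ∀ φ : A →ₗ[R] R, ∃ ψ : B →ₗ[R] R, ∀ a, ψ (f a) = φ a) : ExtVanish R C := by
  intro i hi
  obtain ⟨i, rfl⟩ := Nat.exists_eq_succ_of_ne_zero hi.ne'
  exact subsingleton_ext_of_isShortExact h hB hext i (hA i)

theorem ExtVanish.exists_extend {f : A →ₗ[R] B} {g : B →ₗ[R] C} (h : IsShortExact f g)
    (hC : ExtVanish R C) (φ : A →ₗ[R] R) : ∃ ψ : B →ₗ[R] R, ∀ a, ψ (f a) = φ a := by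
  have : Subsingleton (Abelian.Ext h.sc.X₃ (ModuleCat.of R R) 1) := hC 1 one_pos
  obtain ⟨b, hb⟩ := Abelian.Ext.contravariant_sequence_exact₁ h.shortExact (ModuleCat.of R R)
    (Abelian.Ext.mk₀ (ModuleCat.ofHom φ)) (add_zero 1)
    (Subsingleton.elim _ _)
  obtain ⟨ψ, rfl⟩ := (Abelian.Ext.mk₀_bijective _ _).2 b
  rw [Abelian.Ext.mk₀_comp_mk₀] at hb
  have := (Abelian.Ext.mk₀_bijective _ _).1 hb
  exact ⟨ψ.hom, fun a => congr($(this).hom a)⟩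

/-- If `Ext^1(K, R) = 0` and `0 → R → R → T → 0` is exact, then maps `K → T` lift to `R`. -/
theorem ExtVanish.exists_lift {K T : Type u} [AddCommGroup K] [Module R K]
    [AddCommGroup T] [Module R T] {f : R →ₗ[R] R} {g : R →ₗ[R] T} (h : IsShortExact f g)
    (hK : ExtVanish R K) (φ : K →ₗ[R] T) : ∃ ψ : K →ₗ[R] R, ∀ k, g (ψ k) = φ k := by
  have : Subsingleton (Abelian.Ext (ModuleCat.of R K) h.sc.X₁ 1) := hK 1 one_pos
  obtain ⟨b, hb⟩ := Abelian.Ext.covariant_sequence_exact₃ (ModuleCat.of R K) h.shortExact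
    (Abelian.Ext.mk₀ (ModuleCat.ofHom φ)) (zero_add 1)
    (Subsingleton.elim _ _)
  obtain ⟨ψ, rfl⟩ := (Abelian.Ext.mk₀_bijective _ _).2 b
  rw [Abelian.Ext.mk₀_comp_mk₀] at hb
  have := (Abelian.Ext.mk₀_bijective _ _).1 hb
  exact ⟨ψ.hom, fun a => congr($(this).hom a)⟩

theorem ExtVanish.of_equiv (e : A ≃ₗ[R] B) (hB : ExtVanish R B) : ExtVanish R A :=
  .left (isShortExact_of_equiv.{u} e) hB .of_projective

/-- Dimension shifting for a whole class of modules: if each member of a class is the quotient of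
a projective module by a member of the class from which all maps to `R` extend, then
`Ext^i(-, R)` vanishes on the class for all `i > 0`. -/
theorem ExtVanish.of_class (P : ∀ (M : Type u) [AddCommGroup M] [Module R M], Prop)
    (hP : ∀ (M : Type u) [AddCommGroup M] [Module R M], P M →
      ∃ (K F : ModuleCat.{u} R) (f : K →ₗ[R] F) (g : F →ₗ[R] M), Module.Projective R F ∧
        IsShortExact f g ∧ P K ∧ ∀ φ : K →ₗ[R] R, ∃ ψ : F →ₗ[R] R, ∀ k, ψ (f k) = φ k)
    (M : Type u) [AddCommGroup M] [Module R M] (hM : P M) : ExtVanish R M := by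
  suffices ∀ (i : ℕ) (M : Type u) [AddCommGroup M] [Module R M], P M →
      Subsingleton (Abelian.Ext (ModuleCat.of R M) (ModuleCat.of R R) (i + 1)) by
    intro i hi
    obtain ⟨i, rfl⟩ := Nat.exists_eq_succ_of_ne_zero hi.ne'
    exact this i M hM
  intro i
  induction i with
  | zero =>
    intro M _ _ hM
    obtain ⟨K, F, f, g, hF, hfg, -, hext⟩ := hP M hM
    exact subsingleton_ext_of_isShortExact hfg .of_projective hext 0 (by simp)
  | succ i ih =>
    intro M _ _ hM
    obtain ⟨K, F, f, g, hF, hfg, hK, hext⟩ := hP M hM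
    exact subsingleton_ext_of_isShortExact hfg .of_projective hext (i + 1) fun _ => ih K hK

end Ext

/-! ### Totally reflexive modules and finite G-dimension -/

section TotallyReflexive

variable {R : Type u} [CommRing R] {A B C : Type u} [AddCommGroup A] [Module R A]
    [AddCommGroup B] [Module R B] [AddCommGroup C] [Module R C]

theorem IsTotallyReflexive.extVanish (h : IsTotallyReflexive R A) : ExtVanish R A :=
  h.ext_eq_zero

theorem IsTotallyReflexive.extVanish_dual (h : IsTotallyReflexive R A) :
    ExtVanish R (Module.Dual R A) :=
  h.ext_dual_eq_zero

theorem IsTotallyReflexive.eq_of_forall (h : IsTotallyReflexive R A) {a b : A}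
    (hab : ∀ f : Module.Dual R A, f a = f b) : a = b :=
  h.bijective_dual_eval.1 (LinearMap.ext hab)

theorem IsTotallyReflexive.exists_eq_eval (h : IsTotallyReflexive R A)
    (Λ : Module.Dual R (Module.Dual R A)) : ∃ a, ∀ f, Λ f = f a := by
  obtain ⟨a, rfl⟩ := h.bijective_dual_eval.2 Λ
  exact ⟨a, fun _ => rfl⟩

theorem IsTotallyReflexive.of_projective [Module.Finite R A] [Module.Projective R A] :
    IsTotallyReflexive R A where
  finite := inferInstance
  bijective_dual_eval := (Module.evalEquiv R A).bijective
  ext_eq_zero := ExtVanish.of_projective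
  ext_dual_eq_zero := ExtVanish.of_projective

/-- Given `0 → A → B → C → 0` and `0 → K → G → B → 0`, the kernel of the composite `G → B → C` is
an extension of `A` by `K`. -/
theorem IsShortExact.exists_pullback {K G : Type*} [AddCommGroup K] [Module R K] [AddCommGroup G]
    [Module R G] {f : A →ₗ[R] B} {g : B →ₗ[R] C} (h : IsShortExact f g) {i : K →ₗ[R] G}
    {p : G →ₗ[R] B} (hip : IsShortExact i p) :
    ∃ (i' : K →ₗ[R] LinearMap.ker (g.comp p)) (p' : LinearMap.ker (g.comp p) →ₗ[R] A),
      IsShortExact i' p' := by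
  let i' : K →ₗ[R] LinearMap.ker (g.comp p) := i.codRestrict _ fun k => by
    simp [hip.map_eq_zero]
  let e := LinearEquiv.ofInjective f h.inj
  let q : LinearMap.ker (g.comp p) →ₗ[R] LinearMap.range f :=
    (p.comp (LinearMap.ker (g.comp p)).subtype).codRestrict _ fun v => h.exists_eq v.2
  let p' : LinearMap.ker (g.comp p) →ₗ[R] A := e.symm.toLinearMap.comp q
  have hp' : ∀ v, f (p' v) = p v := fun v =>
    congr((($(e.apply_symm_apply (q v)) : LinearMap.range f) : B))
  refine ⟨i', p', fun a b hab => ?_, fun v => ?_, fun a => ?_⟩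
  · exact hip.inj congr(($hab : G))
  · rw [← h.inj.eq_iff, hp', map_zero]
    constructor
    · intro hv
      obtain ⟨k, hk⟩ := hip.exists_eq hv
      exact ⟨k, Subtype.ext hk⟩
    · rintro ⟨k, rfl⟩
      exact hip.map_eq_zero k
  · obtain ⟨v, hv⟩ := hip.surj (f a)
    refine ⟨⟨v, ?_⟩, h.inj ?_⟩
    · simp [hv, h.map_eq_zero]
    · rw [hp', hv]

/-- The dual of a short exact sequence with `Ext^1(C, R) = 0` is short exact. -/
theorem IsShortExact.dual {f : A →ₗ[R] B} {g : B →ₗ[R] C} (h : IsShortExact f g)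
    (hC : ExtVanish R C) : IsShortExact (Module.Dual.transpose (R := R) g)
      (Module.Dual.transpose (R := R) f) where
  inj := by
    intro φ ψ hφ
    ext c
    obtain ⟨b, rfl⟩ := h.surj c
    exact congr($hφ b)
  exact := by
    intro φ
    constructor
    · intro hφ
      obtain ⟨ψ, hψ⟩ := h.exists_desc φ fun a => congr($hφ a)
      exact ⟨ψ, LinearMap.ext hψ⟩
    · rintro ⟨ψ, rfl⟩
      ext a
      simp [Module.Dual.transpose_apply, h.map_eq_zero]
  surj := by
    intro φ
    obtain ⟨ψ, hψ⟩ := hC.exists_extend h φ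
    exact ⟨ψ, LinearMap.ext hψ⟩

/-- The kernel of a surjection between totally reflexive modules is totally reflexive. -/
theorem IsTotallyReflexive.left [IsNoetherianRing R] {f : A →ₗ[R] B} {g : B →ₗ[R] C}
    (h : IsShortExact f g) (hB : IsTotallyReflexive R B) (hC : IsTotallyReflexive R C) :
    IsTotallyReflexive R A where
  finite := have := hB.finite; h.finite_left
  bijective_dual_eval := by
    constructor
    · rw [injective_iff_map_eq_zero]
      intro a ha
      apply h.inj
      rw [map_zero]
      refine hB.eq_of_forall fun φ => ?_
      rw [map_zero]
      exact congr($ha (φ.comp f))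
    · intro Λ
      obtain ⟨b, hb⟩ := hB.exists_eq_eval (Λ.comp (Module.Dual.transpose (R := R) f))
      have hgb : g b = 0 := by
        refine hC.eq_of_forall fun φ => ?_
        have h1 := hb (φ.comp g)
        have h2 : Module.Dual.transpose (R := R) f (φ.comp g) = 0 := by
          ext a
          simp [Module.Dual.transpose_apply, h.map_eq_zero]
        rw [LinearMap.comp_apply, h2, map_zero] at h1
        rw [map_zero]
        exact h1.symm
      obtain ⟨a, rfl⟩ := h.exists_eq hgb
      refine ⟨a, LinearMap.ext fun φ => ?_⟩
      obtain ⟨ψ, hψ⟩ := hC.extVanish.exists_extend h φ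
      obtain rfl : ψ.comp f = φ := LinearMap.ext hψ
      exact (hb ψ).symm
  ext_eq_zero := hB.extVanish.left h hC.extVanish
  ext_dual_eq_zero := by
    refine hC.extVanish_dual.right (h.dual hC.extVanish) hB.extVanish_dual fun Λ => ?_
    obtain ⟨c, hc⟩ := hC.exists_eq_eval Λ
    obtain ⟨b, rfl⟩ := h.surj c
    exact ⟨Module.Dual.eval R B b, fun φ => (hc φ).symm⟩

/-- An extension of totally reflexive modules is totally reflexive. -/
theorem IsTotallyReflexive.middle {f : A →ₗ[R] B} {g : B →ₗ[R] C}
    (h : IsShortExact f g) (hA : IsTotallyReflexive R A) (hC : IsTotallyReflexive R C) :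
    IsTotallyReflexive R B where
  finite := by
    have := hA.finite
    have := hC.finite
    exact Module.Finite.of_exact h.exact h.surj
  bijective_dual_eval := by
    constructor
    · rw [injective_iff_map_eq_zero]
      intro b hb
      have hgb : g b = 0 := by
        refine hC.eq_of_forall fun φ => ?_
        rw [map_zero]
        exact congr($hb (φ.comp g))
      obtain ⟨a, rfl⟩ := h.exists_eq hgb
      have : a = 0 := by
        refine hA.eq_of_forall fun φ => ?_
        obtain ⟨ψ, hψ⟩ := hC.extVanish.exists_extend h φ
        rw [map_zero, ← hψ]
        exact congr($hb ψ)
      rw [this, map_zero]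
    · intro Λ
      obtain ⟨c, hc⟩ := hC.exists_eq_eval (Λ.comp (Module.Dual.transpose (R := R) g))
      obtain ⟨b, rfl⟩ := h.surj c
      obtain ⟨Γ, hΓ⟩ := (h.dual hC.extVanish).exists_desc (Λ - Module.Dual.eval R B b) fun φ => by
        have := hc φ
        rw [LinearMap.comp_apply] at this
        rw [LinearMap.sub_apply, this, sub_eq_zero]
        rfl
      obtain ⟨a, ha⟩ := hA.exists_eq_eval Γ
      refine ⟨b + f a, LinearMap.ext fun φ => ?_⟩
      have h1 := hΓ φ
      rw [ha, LinearMap.sub_apply, eq_sub_iff_add_eq'] at h1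
      rw [← h1, map_add]
      rfl
  ext_eq_zero := hA.extVanish.middle h hC.extVanish
  ext_dual_eq_zero := hC.extVanish_dual.middle (h.dual hC.extVanish) hA.extVanish_dual

theorem IsTotallyReflexive.of_equiv [IsNoetherianRing R] (e : A ≃ₗ[R] B)
    (hB : IsTotallyReflexive R B) : IsTotallyReflexive R A :=
  .left (isShortExact_of_equiv.{u} e) hB .of_projective

theorem IsTotallyReflexive.dual [IsNoetherianRing R] (hA : IsTotallyReflexive R A) :
    IsTotallyReflexive R (Module.Dual R A) where
  finite := have := hA.finite; inferInstance
  bijective_dual_eval := by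
    have h1 : Function.Bijective
        (Module.Dual.transpose (R := R) (Module.Dual.eval R A)) :=
      (LinearEquiv.ofBijective _ hA.bijective_dual_eval).dualMap.bijective
    refine (Function.Bijective.of_comp_iff' h1 _).1 ?_
    have h2 : Module.Dual.transpose (R := R) (Module.Dual.eval R A) ∘
        Module.Dual.eval R (Module.Dual R A) = id := rfl
    rw [h2]
    exact Function.bijective_id
  ext_eq_zero := hA.extVanish_dual
  ext_dual_eq_zero :=
    hA.extVanish.of_equiv (LinearEquiv.ofBijective _ hA.bijective_dual_eval).symm

end TotallyReflexive

/-- A recursive form of "`M` has G-dimension at most `n`": either `n = 0` and `M` is totally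
reflexive, or `M` is the quotient of a totally reflexive module by a module of G-dimension at
most `n - 1`. -/
def GDimLE (R : Type u) [CommRing R] : ℕ → ∀ (M : Type u) [AddCommGroup M] [Module R M], Prop
  | 0, M, _, _ => IsTotallyReflexive R M
  | n + 1, M, _, _ => ∃ (K G : ModuleCat.{u} R) (f : K →ₗ[R] G) (g : G →ₗ[R] M),
      IsTotallyReflexive R G ∧ IsShortExact f g ∧ GDimLE R n K

section GDimLE

variable {R : Type u} [CommRing R] {A B C : Type u} [AddCommGroup A] [Module R A]
    [AddCommGroup B] [Module R B] [AddCommGroup C] [Module R C]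

theorem gDimLE_zero : GDimLE R 0 A ↔ IsTotallyReflexive R A := Iff.rfl

theorem GDimLE.succ_of_isShortExact {f : A →ₗ[R] B} {g : B →ₗ[R] C} (h : IsShortExact f g)
    (hB : IsTotallyReflexive R B) {n : ℕ} (hA : GDimLE R n A) : GDimLE R (n + 1) C :=
  ⟨.of R A, .of R B, f, g, hB, h, hA⟩

theorem GDimLE.mono_succ : ∀ {n : ℕ} {A : Type u} [AddCommGroup A] [Module R A],
    GDimLE R n A → GDimLE R (n + 1) A
  | 0, A, _, _, h => by
    refine GDimLE.succ_of_isShortExact (f := (0 : PUnit.{u + 1} →ₗ[R] A)) (g := LinearMap.id)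
      ⟨fun _ _ _ => Subsingleton.elim _ _, fun a => ?_, Function.surjective_id⟩ h
      (gDimLE_zero.2 .of_projective)
    exact ⟨fun h => ⟨0, h.symm⟩, fun ⟨_, h⟩ => h.symm⟩
  | n + 1, A, _, _, ⟨_, _, _, _, hG, hfg, hK⟩ =>
    .succ_of_isShortExact hfg hG hK.mono_succ

theorem GDimLE.left [IsNoetherianRing R] : ∀ {n : ℕ} {f : A →ₗ[R] B} {g : B →ₗ[R] C},
    IsShortExact f g → GDimLE R n B → IsTotallyReflexive R C → GDimLE R n A
  | 0, _, _, h, hB, hC => IsTotallyReflexive.left h hB hC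
  | n + 1, f, g, h, ⟨K, G, i, p, hG, hip, hK⟩, hC => by
    have hs : Function.Surjective (g.comp p) := h.surj.comp hip.surj
    have hG' : IsTotallyReflexive R (LinearMap.ker (g.comp p)) :=
      .left (isShortExact_ker_subtype hs) hG hC
    obtain ⟨i', p', hip'⟩ := h.exists_pullback hip
    exact .succ_of_isShortExact hip' hG' hK

theorem GDimLE.middle_of_projective [Module.Finite R C] [Module.Projective R C] :
    ∀ {n : ℕ} {f : A →ₗ[R] B} {g : B →ₗ[R] C},
      IsShortExact f g → GDimLE R n A → GDimLE R n B
  | 0, _, _, h, hA => IsTotallyReflexive.middle h hA .of_projective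
  | n + 1, f, g, h, ⟨K, G, i, p, hG, hip, hK⟩ => by
    obtain ⟨s, hs⟩ := Module.projective_lifting_property g LinearMap.id h.surj
    replace hs : ∀ c, g (s c) = c := fun c => congr($hs c)
    have hGC : IsTotallyReflexive R (G × C) :=
      .middle (f := LinearMap.inl R G C) (g := LinearMap.snd R G C)
        ⟨LinearMap.inl_injective, .inl_snd, LinearMap.snd_surjective⟩ hG .of_projective
    refine .succ_of_isShortExact (f := (LinearMap.inl R G C).comp i)
      (g := (f.comp p).coprod s) ⟨?_, fun v => ?_, fun b => ?_⟩ hGC hK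
    · exact LinearMap.inl_injective.comp hip.inj
    · constructor
      · intro hv
        obtain ⟨v, c⟩ := v
        have hv' : f (p v) + s c = 0 := by simpa using hv
        have hc : c = 0 := by
          have := congr(g $hv')
          simpa [h.map_eq_zero, hs] using this
        subst hc
        obtain ⟨k, rfl⟩ := hip.exists_eq (b := v) (h.inj (by simpa using hv'))
        exact ⟨k, by simp⟩
      · rintro ⟨k, rfl⟩
        simp [hip.map_eq_zero]
    · obtain ⟨a, ha⟩ := h.exists_eq (b := b - s (g b)) (by simp [hs])
      obtain ⟨v, rfl⟩ := hip.surj a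
      exact ⟨(v, g b), by simp [ha]⟩

/-- The kernel of any cover of a module of G-dimension at most `n + 1` by a finitely generated
projective module has G-dimension at most `n`. Both this cover and the given one by a totally
reflexive module are compared with their fibre product. -/
theorem GDimLE.of_cover [IsNoetherianRing R] [Module.Finite R B] [Module.Projective R B] {n : ℕ}
    {f : A →ₗ[R] B} {g : B →ₗ[R] C} (h : IsShortExact f g) (hC : GDimLE R (n + 1) C) :
    GDimLE R n A := by
  obtain ⟨K, G, i, p, hG, hip, hK⟩ := hC
  let P := LinearMap.ker (p.coprod (-g))
  have mem (v : G × B) : v ∈ P ↔ p v.1 = g v.2 := by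
    simp [P, sub_eq_zero, ← sub_eq_add_neg]
  have hP : GDimLE R n P := by
    refine .middle_of_projective (A := K) (C := B)
      (f := ((LinearMap.inl R G B).comp i).codRestrict P fun k => ?_)
      (g := (LinearMap.snd R G B).comp P.subtype) ⟨?_, fun v => ?_, fun b => ?_⟩ hK
    · rw [mem]
      simp [hip.map_eq_zero]
    · intro a b hab
      exact hip.inj congr((($hab : P) : G × B).1)
    · obtain ⟨⟨v, b⟩, hv⟩ := v
      rw [mem] at hv
      constructor
      · intro hb
        obtain rfl : b = 0 := hb
        obtain ⟨k, rfl⟩ := hip.exists_eq (b := v) (by simpa using hv)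
        exact ⟨k, rfl⟩
      · rintro ⟨k, hk⟩
        exact congr((($hk : P) : G × B).2).symm
    · obtain ⟨v, hv⟩ := hip.surj (g b)
      exact ⟨⟨(v, b), (mem _).2 hv⟩, rfl⟩
  refine .left (B := P) (C := G)
    (f := ((LinearMap.inr R G B).comp f).codRestrict P fun k => ?_)
    (g := (LinearMap.fst R G B).comp P.subtype) ⟨?_, fun v => ?_, fun b => ?_⟩ hP hG
  · rw [mem]
    simp [h.map_eq_zero]
  · intro a b hab
    exact h.inj congr((($hab : P) : G × B).2)
  · obtain ⟨⟨b, v⟩, hv⟩ := v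
    rw [mem] at hv
    constructor
    · intro hb
      obtain rfl : b = 0 := hb
      obtain ⟨k, rfl⟩ := h.exists_eq (b := v) (by simpa using hv.symm)
      exact ⟨k, rfl⟩
    · rintro ⟨k, hk⟩
      exact congr((($hk : P) : G × B).1).symm
  · obtain ⟨v, hv⟩ := h.surj (p b)
    exact ⟨⟨(b, v), (mem _).2 hv.symm⟩, rfl⟩

/-- The quotient of a module of positive G-dimension bound by a free submodule satisfies the same
bound. -/
theorem GDimLE.right_of_projective [Module.Finite R A] [Module.Projective R A] {n : ℕ}
    {f : A →ₗ[R] B} {g : B →ₗ[R] C} (h : IsShortExact f g) (hB : GDimLE R (n + 1) B) :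
    GDimLE R (n + 1) C := by
  obtain ⟨K, G, i, p, hG, hip, hK⟩ := hB
  have hs : Function.Surjective (g.comp p) := h.surj.comp hip.surj
  refine .succ_of_isShortExact (isShortExact_ker_subtype hs) hG ?_
  obtain ⟨i', p', hip'⟩ := h.exists_pullback hip
  exact .middle_of_projective hip' hK

/-- A G-resolution of the kernel of a cover by a totally reflexive module extends to a
G-resolution of the quotient. -/
def GResolution.cons {n : ℕ} (P : GResolution R A n) {f : A →ₗ[R] B} {g : B →ₗ[R] C}
    (h : IsShortExact f g) (hB : IsTotallyReflexive R B) : GResolution R C (n + 1) where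
  G := fun i => match i with
    | 0 => .of R B
    | i + 1 => P.G i
  d := fun i => match i with
    | 0 => f.comp P.aug
    | i + 1 => P.d i
  aug := g
  isTotallyReflexive := fun i => match i with
    | 0 => hB
    | i + 1 => P.isTotallyReflexive i
  subsingleton := fun i hi => match i, hi with
    | i + 1, hi => P.subsingleton i (by omega)
  surjective_aug := h.surj
  exact_zero := by
    intro b
    refine (h.exact b).trans ⟨?_, ?_⟩
    · rintro ⟨a, rfl⟩
      obtain ⟨x, rfl⟩ := P.surjective_aug a
      exact ⟨x, rfl⟩
    · rintro ⟨x, rfl⟩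
      exact ⟨P.aug x, rfl⟩
  exact_succ := fun i => match i with
    | 0 => fun x => by
      refine Iff.trans ⟨fun hx => ?_, fun hx => ?_⟩ (P.exact_zero x)
      · exact h.inj (hx.trans (map_zero f).symm)
      · exact (congrArg f hx).trans (map_zero f)
    | i + 1 => P.exact_succ i

/-- The G-resolution of a totally reflexive module that is concentrated in degree `0`. -/
def GResolution.single (hA : IsTotallyReflexive R A) : GResolution R A 0 where
  G := fun i => match i with
    | 0 => .of R A
    | _ + 1 => .of R PUnit
  d := fun _ => 0
  aug := LinearMap.id
  isTotallyReflexive := fun i => match i with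
    | 0 => hA
    | _ + 1 => .of_projective (A := PUnit)
  subsingleton := fun i hi => match i, hi with
    | _ + 1, _ => inferInstanceAs (Subsingleton PUnit)
  surjective_aug := Function.surjective_id
  exact_zero := fun a => ⟨fun h => ⟨0, h.symm⟩, fun ⟨_, h⟩ => h.symm⟩
  exact_succ := fun i x => by
    have hx : ∀ y : PUnit.{u + 1}, y = 0 := fun y => Subsingleton.elim _ _
    exact ⟨fun _ => ⟨0, (hx x).symm⟩, fun _ => by simp⟩

/-- The first syzygy in a G-resolution has a G-resolution which is shorter by one. -/
def GResolution.tail {n : ℕ} (P : GResolution R A (n + 1)) :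
    GResolution R (LinearMap.ker P.aug) n where
  G := fun i => P.G (i + 1)
  d := fun i => P.d (i + 1)
  aug := (P.d 0).codRestrict _ fun x => P.exact_zero.apply_apply_eq_zero x
  isTotallyReflexive := fun i => P.isTotallyReflexive (i + 1)
  subsingleton := fun i hi => P.subsingleton (i + 1) (by omega)
  surjective_aug := by
    rintro ⟨x, hx⟩
    obtain ⟨y, rfl⟩ := (P.exact_zero x).1 hx
    exact ⟨y, rfl⟩
  exact_zero := fun x => by
    refine Iff.trans ?_ (P.exact_succ 0 x)
    exact Subtype.ext_iff
  exact_succ := fun i => P.exact_succ (i + 1)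

theorem GDimLE.nonempty_gResolution : ∀ {n : ℕ} {A : Type u} [AddCommGroup A] [Module R A],
    GDimLE R n A → Nonempty (GResolution R A n)
  | 0, _, _, _, h => ⟨.single h⟩
  | _ + 1, _, _, _, ⟨_, _, _, _, hG, hfg, hK⟩ =>
    let ⟨P⟩ := hK.nonempty_gResolution
    ⟨P.cons hfg hG⟩

theorem GResolution.gDimLE [IsNoetherianRing R] : ∀ {n : ℕ} {A : Type u} [AddCommGroup A]
    [Module R A], GResolution R A n → GDimLE R n A
  | 0, A, _, _, P => by
    have hinj : Function.Injective P.aug := by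
      rw [injective_iff_map_eq_zero]
      intro x hx
      obtain ⟨y, rfl⟩ := (P.exact_zero x).1 hx
      have := P.subsingleton 1 one_pos
      rw [Subsingleton.elim y 0, map_zero]
    exact (P.isTotallyReflexive 0).of_equiv
      (LinearEquiv.ofBijective P.aug ⟨hinj, P.surjective_aug⟩).symm
  | n + 1, A, _, _, P =>
    .succ_of_isShortExact (isShortExact_ker_subtype P.surjective_aug) (P.isTotallyReflexive 0)
      P.tail.gDimLE

theorem gDim_lt_top_iff [IsNoetherianRing R] : gDim R A < ⊤ ↔ ∃ n, GDimLE R n A := by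
  rw [gDim]
  split_ifs with h
  · exact iff_of_true (by simp) ⟨0, IsTotallyReflexive.of_projective⟩
  · rw [sInf_lt_iff]
    constructor
    · rintro ⟨_, ⟨n, rfl, ⟨P⟩⟩, -⟩
      exact ⟨n, P.gDimLE⟩
    · rintro ⟨n, hn⟩
      refine ⟨_, ⟨n, rfl, hn.nonempty_gResolution⟩, ?_⟩
      exact WithBot.coe_lt_coe.2 (ENat.natCast_lt_top n)

theorem hasTG_iff [IsNoetherianRing R] : HasTG R ↔
    ∀ (M : Type u) [AddCommGroup M] [Module R M], Module.Finite R M →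
      HasBoundedSelfTor R M → ∃ n, GDimLE R n M := by
  simp only [HasTG, gDim_lt_top_iff]

end GDimLE

/-! ### Vanishing of `Tor` through projective resolutions -/

/-- A projective resolution of the module `M`, as a sequence of modules and linear maps. -/
structure ModuleResolution (R : Type u) [CommRing R] (M : Type u) [AddCommGroup M]
    [Module R M] where
  /-- the modules of the resolution -/
  F : ℕ → ModuleCat.{u} R
  /-- the differentials -/
  d : ∀ i : ℕ, F (i + 1) →ₗ[R] F i
  /-- the augmentation -/
  aug : F 0 →ₗ[R] M
  projective : ∀ i, Module.Projective R (F i)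
  surjective_aug : Function.Surjective aug
  exact_zero : Function.Exact (d 0) aug
  exact_succ : ∀ i : ℕ, Function.Exact (d (i + 1)) (d i)

/-- `Tor^R_i(N, M) = 0`. -/
def TorZero (R : Type u) [CommRing R] (N M : Type u) [AddCommGroup N] [Module R N]
    [AddCommGroup M] [Module R M] (i : ℕ) : Prop :=
  Limits.IsZero (((Tor (ModuleCat.{u} R) i).obj (ModuleCat.of R N)).obj (ModuleCat.of R M))

section

variable {R : Type u} [CommRing R] {M N : Type u} [AddCommGroup M] [Module R M]
  [AddCommGroup N] [Module R N]

namespace ModuleResolution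

/-- The chain complex of a resolution. -/
def complex (P : ModuleResolution R M) : ChainComplex (ModuleCat.{u} R) ℕ :=
  ChainComplex.of P.F (fun i => ModuleCat.ofHom (P.d i)) fun i =>
    ModuleCat.hom_ext (P.exact_succ i).linearMap_comp_eq_zero

theorem complex_d (P : ModuleResolution R M) (i : ℕ) :
    P.complex.d (i + 1) i = ModuleCat.ofHom (P.d i) :=
  ChainComplex.of_d P.F (fun i => ModuleCat.ofHom (P.d i)) i

/-- The augmentation, as a map to the complex concentrated in degree `0`. -/
def toSingle (P : ModuleResolution R M) :
    P.complex ⟶ (ChainComplex.single₀ (ModuleCat.{u} R)).obj (ModuleCat.of R M) :=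
  (ChainComplex.toSingle₀Equiv P.complex (ModuleCat.of R M)).symm
    ⟨(ModuleCat.ofHom P.aug : P.F 0 ⟶ ModuleCat.of R M), by
      rw [P.complex_d]
      exact ModuleCat.hom_ext P.exact_zero.linearMap_comp_eq_zero⟩

theorem toSingle_f_zero (P : ModuleResolution R M) :
    P.toSingle.f 0 = (ModuleCat.ofHom P.aug : P.F 0 ⟶ ModuleCat.of R M) :=
  ChainComplex.toSingle₀Equiv_symm_apply_f_zero _ _

/-- A sequence of modules that resolves `M` gives a projective resolution in the sense of
abelian categories. -/
def projectiveResolution (P : ModuleResolution R M) :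
    ProjectiveResolution (ModuleCat.of R M) where
  complex := P.complex
  projective i := by
    have := P.projective i
    exact (IsProjective.iff_projective (P.F i)).1 inferInstance
  π := P.toSingle
  quasiIso := ⟨fun n => by
    cases n with
    | zero =>
      rw [ChainComplex.quasiIsoAt₀_iff, ShortComplex.quasiIso_iff_of_zeros']
      · refine ⟨?_, ?_⟩
        · rw [ShortComplex.moduleCat_exact_iff]
          intro (x : P.F 0) (hx : P.toSingle.f 0 x = 0)
          rw [toSingle_f_zero] at hx
          obtain ⟨y, rfl⟩ := (P.exact_zero x).1 hx
          refine ⟨y, ?_⟩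
          change P.complex.d 1 0 y = P.d 0 y
          rw [P.complex_d]
          rfl
        · rw [ModuleCat.epi_iff_surjective]
          change Function.Surjective (P.toSingle.f 0)
          rw [toSingle_f_zero]
          exact P.surjective_aug
      all_goals rfl
    | succ n =>
      rw [quasiIsoAt_iff_exactAt']
      · rw [HomologicalComplex.exactAt_iff' _ (n + 1 + 1) (n + 1) n (by simp) (by simp),
          ShortComplex.moduleCat_exact_iff]
        intro (x : P.F (n + 1)) (hx : P.complex.d (n + 1) n x = 0)
        rw [P.complex_d] at hx
        obtain ⟨y, rfl⟩ := (P.exact_succ n x).1 hx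
        refine ⟨y, ?_⟩
        change P.complex.d (n + 1 + 1) (n + 1) y = P.d (n + 1) y
        rw [P.complex_d]
        rfl
      · apply ChainComplex.exactAt_succ_single_obj⟩

theorem torZero_iff (P : ModuleResolution R M) (i : ℕ) :
    TorZero R N M (i + 1) ↔
      Function.Exact ((P.d (i + 1)).lTensor N) ((P.d i).lTensor N) := by
  let T := (MonoidalCategory.tensoringLeft (ModuleCat.{u} R)).obj (ModuleCat.of R N)
  have h1 := (P.projectiveResolution.isoLeftDerivedObj T (i + 1)).isZero_iff
  have h2 := ((T.mapHomologicalComplex _).obj P.complex).exactAt_iff_isZero_homology (i + 1)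
  have hd (j : ℕ) (x : N ⊗[R] P.F (j + 1)) :
      ((T.mapHomologicalComplex _).obj P.complex).d (j + 1) j x = (P.d j).lTensor N x := by
    change T.map (P.complex.d (j + 1) j) x = _
    rw [P.complex_d]
    rfl
  refine h1.trans (h2.symm.trans ?_)
  rw [HomologicalComplex.exactAt_iff' _ (i + 1 + 1) (i + 1) i (by simp) (by simp),
    ShortComplex.moduleCat_exact_iff]
  constructor
  · intro h x
    refine ⟨fun hx => ?_, ?_⟩
    · obtain ⟨y, hy⟩ := h x ((hd i x).trans hx)
      exact ⟨y, (hd (i + 1) y).symm.trans hy⟩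
    · rintro ⟨y, rfl⟩
      rw [← LinearMap.comp_apply, ← LinearMap.lTensor_comp,
        (P.exact_succ i).linearMap_comp_eq_zero, LinearMap.lTensor_zero, LinearMap.zero_apply]
  · intro h x hx
    obtain ⟨y, hy⟩ := (h x).1 ((hd i x).symm.trans hx)
    exact ⟨y, (hd (i + 1) y).trans hy⟩

theorem lTensor_d_d (P : ModuleResolution R M) (i : ℕ) (x : N ⊗[R] P.F (i + 2)) :
    (P.d i).lTensor N ((P.d (i + 1)).lTensor N x) = 0 := by
  rw [← LinearMap.comp_apply, ← LinearMap.lTensor_comp,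
    (P.exact_succ i).linearMap_comp_eq_zero, LinearMap.lTensor_zero, LinearMap.zero_apply]

/-- A resolution of the kernel of a cover by a projective module extends to a resolution of the
quotient. -/
def cons {A B C : Type u} [AddCommGroup A] [Module R A]
    [AddCommGroup B] [Module R B] [AddCommGroup C] [Module R C] (P : ModuleResolution R A)
    {f : A →ₗ[R] B} {g : B →ₗ[R] C} (h : IsShortExact f g) [hB : Module.Projective R B] :
    ModuleResolution R C where
  F := fun i => match i with
    | 0 => .of R B
    | i + 1 => P.F i
  d := fun i => match i with
    | 0 => f.comp P.aug
    | i + 1 => P.d i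
  aug := g
  projective := fun i => match i with
    | 0 => hB
    | i + 1 => P.projective i
  surjective_aug := h.surj
  exact_zero := by
    intro b
    refine (h.exact b).trans ⟨?_, ?_⟩
    · rintro ⟨a, rfl⟩
      obtain ⟨x, rfl⟩ := P.surjective_aug a
      exact ⟨x, rfl⟩
    · rintro ⟨x, rfl⟩
      exact ⟨P.aug x, rfl⟩
  exact_succ := fun i => match i with
    | 0 => fun x => by
      refine Iff.trans ⟨fun hx => ?_, fun hx => ?_⟩ (P.exact_zero x)
      · exact h.inj (hx.trans (map_zero f).symm)
      · exact (congrArg f hx).trans (map_zero f)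
    | i + 1 => P.exact_succ i

/-- The iterated kernels of the canonical covers `Z →₀ R → Z`, starting from `M`. -/
def canonicalSyzygy (R : Type u) [CommRing R] (M : Type u) [AddCommGroup M] [Module R M] :
    ℕ → ModuleCat.{u} R
  | 0 => .of R M
  | n + 1 => .of R (LinearMap.ker (Finsupp.linearCombination R
      (id : canonicalSyzygy R M n → canonicalSyzygy R M n)))

/-- The resolution of `M` by the free modules on the underlying sets of its iterated syzygies. -/
def canonical (R : Type u) [CommRing R] (M : Type u) [AddCommGroup M] [Module R M] :
    ModuleResolution R M where
  F n := .of R (canonicalSyzygy R M n →₀ R)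
  d n := (LinearMap.ker (Finsupp.linearCombination R
      (id : canonicalSyzygy R M n → canonicalSyzygy R M n))).subtype.comp
    (Finsupp.linearCombination R (id : canonicalSyzygy R M (n + 1) → canonicalSyzygy R M (n + 1)))
  aug := Finsupp.linearCombination R (id : M → M)
  projective n := inferInstanceAs (Module.Projective R (canonicalSyzygy R M n →₀ R))
  surjective_aug := Finsupp.linearCombination_id_surjective R M
  exact_zero x := by
    constructor
    · intro hx
      obtain ⟨y, hy⟩ := Finsupp.linearCombination_id_surjective R (canonicalSyzygy R M 1) ⟨x, hx⟩
      exact ⟨y, congrArg Subtype.val hy⟩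
    · rintro ⟨y, rfl⟩
      exact (Finsupp.linearCombination R (id : canonicalSyzygy R M 1 → canonicalSyzygy R M 1) y).2
  exact_succ n x := by
    have h0 : Finsupp.linearCombination R
        (id : canonicalSyzygy R M (n + 1) → canonicalSyzygy R M (n + 1)) x = 0 ↔
        ((LinearMap.ker (Finsupp.linearCombination R
          (id : canonicalSyzygy R M n → canonicalSyzygy R M n))).subtype.comp
          (Finsupp.linearCombination R
            (id : canonicalSyzygy R M (n + 1) → canonicalSyzygy R M (n + 1)))) x = 0 :=
      Subtype.ext_iff
    refine h0.symm.trans ?_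
    constructor
    · intro hx
      obtain ⟨y, hy⟩ :=
        Finsupp.linearCombination_id_surjective R (canonicalSyzygy R M (n + 2)) ⟨x, hx⟩
      exact ⟨y, congrArg Subtype.val hy⟩
    · rintro ⟨y, rfl⟩
      exact (Finsupp.linearCombination R
        (id : canonicalSyzygy R M (n + 2) → canonicalSyzygy R M (n + 2)) y).2

end ModuleResolution

end

/-! ### Dimension shifting and symmetry for the vanishing of `Tor` -/

section Shift

variable {R : Type u} [CommRing R] {A B C M N : Type u} [AddCommGroup A] [Module R A]
  [AddCommGroup B] [Module R B] [AddCommGroup C] [Module R C] [AddCommGroup M] [Module R M]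
  [AddCommGroup N] [Module R N]

theorem TorZero.of_flat [Module.Flat R N] (i : ℕ) : TorZero R N M (i + 1) :=
  ((ModuleResolution.canonical R M).torZero_iff i).2
    (Module.Flat.lTensor_exact N ((ModuleResolution.canonical R M).exact_succ i))

/-- Dimension shifting in the second variable. -/
theorem torZero_succ_succ_iff_right [Module.Projective R B] {f : A →ₗ[R] B} {g : B →ₗ[R] C}
    (h : IsShortExact f g) (i : ℕ) : TorZero R N C (i + 2) ↔ TorZero R N A (i + 1) :=
  ((((ModuleResolution.canonical R A).cons h).torZero_iff (i + 1))).trans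
    ((ModuleResolution.canonical R A).torZero_iff i).symm

theorem torZero_one_iff_right [Module.Projective R B] {f : A →ₗ[R] B} {g : B →ₗ[R] C}
    (h : IsShortExact f g) : TorZero R N C 1 ↔ Function.Injective (f.lTensor N) := by
  let P := ModuleResolution.canonical R A
  have hex := lTensor_exact N P.exact_zero P.surjective_aug
  have hsurj := LinearMap.lTensor_surjective N P.surjective_aug
  refine ((P.cons h).torZero_iff 0).trans ?_
  change Function.Exact ((P.d 0).lTensor N) ((f.comp P.aug).lTensor N) ↔ _
  rw [LinearMap.lTensor_comp, injective_iff_map_eq_zero]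
  constructor
  · intro hE z hz
    obtain ⟨y, rfl⟩ := hsurj z
    obtain ⟨w, rfl⟩ := (hE y).1 hz
    exact hex.apply_apply_eq_zero w
  · intro hinj y
    refine ⟨fun hy => (hex y).1 (hinj _ hy), ?_⟩
    rintro ⟨w, rfl⟩
    exact (congrArg _ (hex.apply_apply_eq_zero w)).trans (map_zero _)

theorem IsShortExact.rTensor {f : A →ₗ[R] B} {g : B →ₗ[R] C} (h : IsShortExact f g)
    (F : Type u) [AddCommGroup F] [Module R F] [Module.Flat R F] :
    IsShortExact (f.rTensor F) (g.rTensor F) :=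
  ⟨Module.Flat.rTensor_preserves_injective_linearMap f h.inj, rTensor_exact F h.exact h.surj,
    LinearMap.rTensor_surjective F h.surj⟩

theorem lTensor_rTensor_apply {F F' : Type*} [AddCommGroup F] [Module R F] [AddCommGroup F']
    [Module R F'] (f : A →ₗ[R] B) (d : F →ₗ[R] F') (x : A ⊗[R] F) :
    d.lTensor B (f.rTensor F x) = f.rTensor F' (d.lTensor A x) := by
  rw [← LinearMap.comp_apply, ← LinearMap.comp_apply, LinearMap.lTensor_comp_rTensor,
    LinearMap.rTensor_comp_lTensor]

section Chase

variable {f : A →ₗ[R] B} {g : B →ₗ[R] C} (h : IsShortExact f g) (P : ModuleResolution R M)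
include h

/-- A diagram chase in `0 → A ⊗ P → B ⊗ P → C ⊗ P → 0`. -/
theorem mem_range_of_torZero_right {i : ℕ} (hC : TorZero R C M (i + 1)) (a : A ⊗[R] P.F i)
    (b : B ⊗[R] P.F (i + 1)) (hab : f.rTensor _ a = (P.d i).lTensor B b) :
    ∃ a', (P.d i).lTensor A a' = a := by
  have hP := P.projective
  have hC' := (P.torZero_iff i).1 hC
  obtain ⟨c, hc⟩ := (hC' (g.rTensor _ b)).1 (by
    rw [lTensor_rTensor_apply, ← hab]
    exact (h.rTensor _).map_eq_zero a)
  obtain ⟨b', rfl⟩ := (h.rTensor (P.F (i + 2))).surj c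
  obtain ⟨a', ha'⟩ := (h.rTensor (P.F (i + 1))).exists_eq (b := b - (P.d (i + 1)).lTensor B b') (by
    rw [map_sub, ← lTensor_rTensor_apply, hc, sub_self])
  refine ⟨a', (h.rTensor (P.F i)).inj ?_⟩
  rw [← lTensor_rTensor_apply, ha', map_sub, P.lTensor_d_d, sub_zero, hab]

/-- A diagram chase in `0 → A ⊗ P → B ⊗ P → C ⊗ P → 0`. -/
theorem torZero_right_of_mem_range {i : ℕ} (hB : TorZero R B M (i + 1))
    (hA : ∀ (a : A ⊗[R] P.F i) (b : B ⊗[R] P.F (i + 1)),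
      f.rTensor _ a = (P.d i).lTensor B b → ∃ a', (P.d i).lTensor A a' = a) :
    TorZero R C M (i + 1) := by
  have hP := P.projective
  refine (P.torZero_iff i).2 fun c => ⟨fun hc => ?_, ?_⟩
  · obtain ⟨b, rfl⟩ := (h.rTensor _).surj c
    rw [lTensor_rTensor_apply] at hc
    obtain ⟨a, ha⟩ := (h.rTensor _).exists_eq hc
    obtain ⟨a', rfl⟩ := hA a b ha
    obtain ⟨b', hb'⟩ := ((P.torZero_iff i).1 hB (b - f.rTensor _ a')).1 (by
      rw [map_sub, lTensor_rTensor_apply, ha, sub_self])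
    refine ⟨g.rTensor _ b', ?_⟩
    rw [lTensor_rTensor_apply, hb', map_sub, (h.rTensor _).map_eq_zero, sub_zero]
  · rintro ⟨x, rfl⟩
    exact P.lTensor_d_d i x

end Chase

/-- If `Tor_(i+1)(B, M) = 0 = Tor_(i+2)(C, M)` then `Tor_(i+1)(A, M) = 0`. -/
theorem TorZero.left {f : A →ₗ[R] B} {g : B →ₗ[R] C} (h : IsShortExact f g) {i : ℕ}
    (hB : TorZero R B M (i + 1)) (hC : TorZero R C M (i + 2)) : TorZero R A M (i + 1) := by
  let P := ModuleResolution.canonical R M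
  have hP := P.projective
  refine (P.torZero_iff i).2 fun a => ⟨fun ha => ?_, ?_⟩
  · obtain ⟨b, hb⟩ := ((P.torZero_iff i).1 hB (f.rTensor _ a)).1 (by
      rw [lTensor_rTensor_apply, ha, map_zero])
    exact mem_range_of_torZero_right h P hC a b hb.symm
  · rintro ⟨x, rfl⟩
    exact P.lTensor_d_d i x

/-- If `Tor_(i+1)(A, M) = 0 = Tor_(i+2)(B, M)` then `Tor_(i+2)(C, M) = 0`. -/
theorem TorZero.right {f : A →ₗ[R] B} {g : B →ₗ[R] C} (h : IsShortExact f g) {i : ℕ}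
    (hA : TorZero R A M (i + 1)) (hB : TorZero R B M (i + 2)) : TorZero R C M (i + 2) := by
  let P := ModuleResolution.canonical R M
  have hP := P.projective
  refine torZero_right_of_mem_range h P hB fun a b hab => ?_
  refine ((P.torZero_iff i).1 hA a).1 ((h.rTensor _).inj ?_)
  rw [← lTensor_rTensor_apply, hab, P.lTensor_d_d, map_zero]

theorem TorZero.middle {f : A →ₗ[R] B} {g : B →ₗ[R] C} (h : IsShortExact f g) {i : ℕ}
    (hA : TorZero R A M (i + 1)) (hC : TorZero R C M (i + 1)) : TorZero R B M (i + 1) := by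
  let P := ModuleResolution.canonical R M
  have hP := P.projective
  refine (P.torZero_iff i).2 fun b => ⟨fun hb => ?_, ?_⟩
  · obtain ⟨c, hc⟩ := ((P.torZero_iff i).1 hC (g.rTensor _ b)).1 (by
      rw [lTensor_rTensor_apply, hb, map_zero])
    obtain ⟨b', rfl⟩ := (h.rTensor _).surj c
    obtain ⟨a, ha⟩ := (h.rTensor _).exists_eq (b := b - (P.d (i + 1)).lTensor B b') (by
      rw [map_sub, ← lTensor_rTensor_apply, hc, sub_self])
    obtain ⟨a', rfl⟩ := ((P.torZero_iff i).1 hA a).1 ((h.rTensor _).inj (by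
      rw [← lTensor_rTensor_apply, ha, map_sub, P.lTensor_d_d, hb, sub_zero, map_zero]))
    refine ⟨f.rTensor _ a' + b', ?_⟩
    rw [map_add, lTensor_rTensor_apply, ha, sub_add_cancel]
  · rintro ⟨x, rfl⟩
    exact P.lTensor_d_d i x

/-- Dimension shifting in the first variable. -/
theorem torZero_succ_succ_iff_left [Module.Flat R B] {f : A →ₗ[R] B} {g : B →ₗ[R] C}
    (h : IsShortExact f g) (i : ℕ) : TorZero R C M (i + 2) ↔ TorZero R A M (i + 1) :=
  ⟨fun hC => .left h (.of_flat i) hC, fun hA => .right h hA (.of_flat (i + 1))⟩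

theorem torZero_one_iff_left [Module.Flat R B] {f : A →ₗ[R] B} {g : B →ₗ[R] C}
    (h : IsShortExact f g) : TorZero R C M 1 ↔ Function.Injective (f.rTensor M) := by
  let P := ModuleResolution.canonical R M
  have hP := P.projective
  have hexA := lTensor_exact A P.exact_zero P.surjective_aug
  have hexB := lTensor_exact B P.exact_zero P.surjective_aug
  constructor
  · intro hC
    rw [injective_iff_map_eq_zero]
    intro z hz
    obtain ⟨a, rfl⟩ := LinearMap.lTensor_surjective A P.surjective_aug z
    rw [← lTensor_rTensor_apply] at hz
    obtain ⟨b, hb⟩ := (hexB _).1 hz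
    obtain ⟨a', rfl⟩ := mem_range_of_torZero_right h P hC a b hb.symm
    exact hexA.apply_apply_eq_zero a'
  · intro hinj
    refine torZero_right_of_mem_range h P (.of_flat 0) fun a b hab => ?_
    refine (hexA a).1 (hinj ?_)
    rw [← lTensor_rTensor_apply, hab, map_zero]
    exact hexB.apply_apply_eq_zero b

/-- The vanishing of `Tor_i(N, M)` is symmetric in the two modules. -/
theorem torZero_comm (N M : Type u) [AddCommGroup M] [Module R M] [AddCommGroup N] [Module R N]
    (i : ℕ) : TorZero R N M (i + 1) ↔ TorZero R M N (i + 1) := by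
  have cover (M : Type u) [AddCommGroup M] [Module R M] := isShortExact_ker_subtype
    (Finsupp.linearCombination_id_surjective R M)
  induction i generalizing N M with
  | zero =>
    rw [zero_add, torZero_one_iff_right (cover M), torZero_one_iff_left (cover M),
      LinearMap.lTensor_inj_iff_rTensor_inj]
  | succ i ih =>
    rw [torZero_succ_succ_iff_right (cover M), torZero_succ_succ_iff_left (cover M)]
    exact ih _ _

end Shift

/-! ### Change of rings -/

section BaseChange

variable {S : Type u} [CommRing S] {T : Type u} [CommRing T] [Algebra S T]
  {A B C M N : Type u} [AddCommGroup A] [Module S A]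
  [AddCommGroup B] [Module S B] [AddCommGroup C] [Module S C] [AddCommGroup M] [Module S M]
  [AddCommGroup N] [Module S N]

variable (S T) in
/-- `Tor^S_i(T, M) = 0` for all `i > 0`. -/
def TorIndependent (M : Type u) [AddCommGroup M] [Module S M] : Prop :=
  ∀ i, TorZero S T M (i + 1)

theorem TorIndependent.of_flat [Module.Flat S T] : TorIndependent S T M :=
  fun i => .of_flat i

theorem TorIndependent.left [Module.Projective S B] {f : A →ₗ[S] B} {g : B →ₗ[S] C}
    (h : IsShortExact f g) (hC : TorIndependent S T C) : TorIndependent S T A :=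
  fun i => (torZero_succ_succ_iff_right h i).1 (hC (i + 1))

theorem IsShortExact.baseChange [Module.Projective S B] {f : A →ₗ[S] B} {g : B →ₗ[S] C}
    (h : IsShortExact f g) (hC : TorIndependent S T C) :
    IsShortExact (f.baseChange T) (g.baseChange T) where
  inj := (torZero_one_iff_right h).1 (hC 0)
  exact := lTensor_exact T h.exact h.surj
  surj := LinearMap.lTensor_surjective T h.surj

/-- The base change of a resolution of a Tor-independent module. -/
def ModuleResolution.baseChange (P : ModuleResolution S M) (hM : TorIndependent S T M) :
    ModuleResolution T (T ⊗[S] M) where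
  F i := .of T (T ⊗[S] P.F i)
  d i := (P.d i).baseChange T
  aug := P.aug.baseChange T
  projective i := by
    have := P.projective i
    infer_instance
  surjective_aug := LinearMap.lTensor_surjective T P.surjective_aug
  exact_zero := lTensor_exact T P.exact_zero P.surjective_aug
  exact_succ i := (P.torZero_iff i).1 (hM i)

/-- If `M` is Tor-independent of `T` then `Tor^T_i(N, T ⊗ M) = Tor^S_i(N, M)` for all
`T`-modules `N`. -/
theorem torZero_baseChange_iff [Module T N] [IsScalarTower S T N] (hM : TorIndependent S T M)
    (i : ℕ) : TorZero T N (T ⊗[S] M) (i + 1) ↔ TorZero S N M (i + 1) := by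
  let P := ModuleResolution.canonical S M
  rw [P.torZero_iff i, (P.baseChange hM).torZero_iff i]
  let e (i : ℕ) : N ⊗[T] (T ⊗[S] P.F i) ≃ₗ[T] N ⊗[S] P.F i :=
    AlgebraTensorModule.cancelBaseChange S T T N (P.F i)
  have he (i : ℕ) (z : N ⊗[T] (T ⊗[S] P.F (i + 1))) :
      (P.d i).lTensor N (e (i + 1) z) = e i (((P.d i).baseChange T).lTensor N z) := by
    induction z with
    | zero => simp
    | add a b ha hb => simp only [map_add, ha, hb]
    | tmul n y =>
      induction y with
      | zero => simp
      | add a b ha hb => simp only [tmul_add, map_add, ha, hb]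
      | tmul t y => simp [e]
  constructor
  · intro h y
    constructor
    · intro hy
      obtain ⟨z, rfl⟩ := (e (i + 1)).surjective y
      rw [he, LinearEquiv.map_eq_zero_iff] at hy
      obtain ⟨w, rfl⟩ := (h z).1 hy
      exact ⟨e (i + 2) w, he (i + 1) w⟩
    · rintro ⟨y, rfl⟩
      exact P.lTensor_d_d i y
  · intro h (z : N ⊗[T] (T ⊗[S] P.F (i + 1)))
    constructor
    · intro (hz : ((P.d i).baseChange T).lTensor N z = 0)
      obtain ⟨y, hy⟩ := (h (e (i + 1) z)).1 (by rw [he, hz, map_zero])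
      obtain ⟨w, rfl⟩ := (e (i + 2)).surjective y
      rw [he, EmbeddingLike.apply_eq_iff_eq] at hy
      exact ⟨w, hy⟩
    · rintro ⟨z, rfl⟩
      exact (P.baseChange hM).lTensor_d_d i z

/-- A finite bound on the G-dimension descends along base change if total reflexivity does. -/
theorem GDimLE.of_baseChange [IsNoetherianRing S] [IsNoetherianRing T]
    (hTR : ∀ (G : Type u) [AddCommGroup G] [Module S G], Module.Finite S G →
      TorIndependent S T G → IsTotallyReflexive T (T ⊗[S] G) → IsTotallyReflexive S G) :
    ∀ {n : ℕ} {G : Type u} [AddCommGroup G] [Module S G], Module.Finite S G →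
      TorIndependent S T G → GDimLE T n (T ⊗[S] G) → GDimLE S n G
  | 0, G, _, _, hfin, hG, h => hTR G hfin hG h
  | n + 1, G, _, _, hfin, hG, h => by
    obtain ⟨r, p, hp⟩ := exists_free_cover S G
    have hs := isShortExact_ker_subtype hp
    exact .succ_of_isShortExact hs .of_projective <|
      GDimLE.of_baseChange hTR hs.finite_left (hG.left hs) (h.of_cover (hs.baseChange hG))

end BaseChange

/-! ### Quotients by a regular element -/

/-- The `S`-algebra `T` is the quotient of `S` by the regular element `x`. -/
structure IsQuotientBy (S T : Type*) [CommRing S] [CommRing T] [Algebra S T] (x : S) : Prop where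
  surj : Function.Surjective (algebraMap S T)
  map_eq_zero_iff : ∀ s, algebraMap S T s = 0 ↔ ∃ t, x * t = s
  regular : ∀ s, x * s = 0 → s = 0

namespace IsQuotientBy

variable {S : Type u} [CommRing S] {T : Type u} [CommRing T] [Algebra S T] {x : S}
  (h : IsQuotientBy S T x) {A B C M N : Type u} [AddCommGroup A] [Module S A]
  [AddCommGroup B] [Module S B] [AddCommGroup C] [Module S C] [AddCommGroup M] [Module S M]
  [AddCommGroup N] [Module T N]

include h

theorem isShortExact : IsShortExact (x • LinearMap.id : S →ₗ[S] S) (Algebra.linearMap S T) where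
  inj := by
    rw [injective_iff_map_eq_zero]
    exact h.regular
  exact := h.map_eq_zero_iff
  surj := h.surj

theorem isNoetherianRing [IsNoetherianRing S] : IsNoetherianRing T :=
  isNoetherianRing_of_surjective S T (algebraMap S T) h.surj

theorem map_self : algebraMap S T x = 0 := (h.map_eq_zero_iff x).2 ⟨1, mul_one x⟩

theorem smul_eq_zero [Module S N] [IsScalarTower S T N] (v : N) : x • v = 0 := by
  rw [← algebraMap_smul T x v, h.map_self, zero_smul]

theorem exists_one_tmul (z : T ⊗[S] A) : ∃ a : A, 1 ⊗ₜ[S] a = z :=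
  TensorProduct.mk_surjective S A T h.surj z

theorem one_tmul_eq_zero_iff (a : A) : (1 : T) ⊗ₜ[S] a = 0 ↔ ∃ b, x • b = a := by
  constructor
  · intro ha
    have hex := rTensor_exact A h.isShortExact.exact h.isShortExact.surj
    obtain ⟨z, hz⟩ := (hex (1 ⊗ₜ a)).1 (by simpa using ha)
    refine ⟨TensorProduct.lid S A z, ?_⟩
    have := congrArg (TensorProduct.lid S A) hz
    simpa [LinearMap.rTensor_smul] using this
  · rintro ⟨b, rfl⟩
    rw [← TensorProduct.smul_tmul, Algebra.smul_def, mul_one, h.map_self, TensorProduct.zero_tmul]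

theorem torIndependent (hM : ∀ m : M, x • m = 0 → m = 0) : TorIndependent S T M := by
  intro i
  cases i with
  | zero =>
    rw [zero_add, torZero_one_iff_left h.isShortExact, injective_iff_map_eq_zero]
    intro z hz
    rw [LinearMap.rTensor_smul, LinearMap.rTensor_id, LinearMap.smul_apply, LinearMap.id_apply] at hz
    apply (TensorProduct.lid S M).injective
    rw [map_zero]
    apply hM
    rw [← map_smul, hz, map_zero]
  | succ i => exact (torZero_succ_succ_iff_left h.isShortExact i).2 (.of_flat i)

/-- A linear map all of whose values are divisible by `x` is itself divisible by `x`. -/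
theorem exists_smul_eq (L : A →ₗ[S] S) (hL : ∀ a, algebraMap S T (L a) = 0) :
    ∃ L' : A →ₗ[S] S, ∀ a, L a = x * L' a := by
  let e := LinearEquiv.ofInjective (x • LinearMap.id : S →ₗ[S] S) h.isShortExact.inj
  let q : A →ₗ[S] LinearMap.range (x • LinearMap.id : S →ₗ[S] S) :=
    L.codRestrict _ fun a => (h.map_eq_zero_iff _).1 (hL a)
  refine ⟨e.symm.toLinearMap.comp q, fun a => ?_⟩
  exact congr((($(e.apply_symm_apply (q a)) : LinearMap.range _) : S)).symm

end IsQuotientBy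

/-! ### Base change of the dual module -/

section DualBaseChange

variable {S : Type u} [CommRing S] (T : Type u) [CommRing T] [Algebra S T]
  (A : Type u) {B : Type u} [AddCommGroup A] [Module S A] [AddCommGroup B] [Module S B]

/-- The comparison map `T ⊗ A* → (T ⊗ A)*`. -/
def dualBaseChange : T ⊗[S] Module.Dual S A →ₗ[T] Module.Dual T (T ⊗[S] A) :=
  (Module.Dual.baseChange (R := S) (V := A) T).liftBaseChange T

variable {A}

theorem dualBaseChange_tmul (t t' : T) (g : Module.Dual S A) (a : A) :
    dualBaseChange T A (t ⊗ₜ g) (t' ⊗ₜ a) = t * (g a • t') := by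
  simp [dualBaseChange]

theorem dualBaseChange_one_tmul (g : Module.Dual S A) (a : A) :
    dualBaseChange T A (1 ⊗ₜ g) (1 ⊗ₜ a) = algebraMap S T (g a) := by
  rw [dualBaseChange_tmul, one_mul, Algebra.algebraMap_eq_smul_one]

theorem dualBaseChange_transpose (f : A →ₗ[S] B) (z : T ⊗[S] Module.Dual S B) :
    dualBaseChange T A ((Module.Dual.transpose (R := S) f).baseChange T z) =
      (dualBaseChange T B z).comp (f.baseChange T) := by
  induction z with
  | zero => simp
  | add z w hz hw => rw [map_add, map_add, hz, hw, map_add, LinearMap.add_comp]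
  | tmul t g =>
    ext a
    simp [dualBaseChange_tmul, Module.Dual.transpose_apply]

theorem dualBaseChange_bijective_of_flat [IsNoetherianRing S] [Module.Flat S T]
    [Module.Finite S A] : Function.Bijective (dualBaseChange (S := S) T A) := by
  have : Module.FinitePresentation S A := Module.finitePresentation_of_finite S A
  let e := (Module.FinitePresentation.isBaseChange_map S A S T).equiv ≪≫ₗ
    (AlgebraTensorModule.rid S T T).congrRight (M := T ⊗[S] A)
  have : dualBaseChange (S := S) T A = e.toLinearMap := by
    ext g a
    simp [e, dualBaseChange_tmul, IsBaseChange.equiv_tmul]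
    rfl
  rw [this]
  exact e.bijective

end DualBaseChange

/-! ### Descent along faithfully flat maps -/

theorem TorZero.baseChange_of_flat {S : Type u} [CommRing S] {T : Type u} [CommRing T]
    [Algebra S T] [Module.Flat S T] {M N : Type u} [AddCommGroup M] [Module S M]
    [AddCommGroup N] [Module S N] {i : ℕ}
    (h : TorZero S N M (i + 1)) : TorZero T (T ⊗[S] N) (T ⊗[S] M) (i + 1) := by
  rw [torZero_baseChange_iff .of_flat]
  let P := ModuleResolution.canonical S M
  have hP := Module.Flat.lTensor_exact T ((P.torZero_iff i).1 h)
  refine (P.torZero_iff i).2 ?_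
  rw [LinearMap.lTensor_tensor, LinearMap.lTensor_tensor]
  intro z
  have h1 := hP (TensorProduct.assoc S T N _ z)
  constructor
  · intro hz
    obtain ⟨w, hw⟩ := h1.1 (by simpa using hz)
    refine ⟨(TensorProduct.assoc S T N _).symm w, ?_⟩
    simp [hw]
  · rintro ⟨w, rfl⟩
    have := hP.apply_apply_eq_zero (TensorProduct.assoc S T N _ w)
    simpa using this

theorem hasBoundedSelfTor_iff {R : Type u} [CommRing R] {M : Type u} [AddCommGroup M]
    [Module R M] : HasBoundedSelfTor R M ↔ ∃ n, ∀ i, n ≤ i → TorZero R M M (i + 1) := by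
  constructor
  · rintro ⟨n, hn⟩
    exact ⟨n, fun i hi => hn (i + 1) (by omega)⟩
  · rintro ⟨n, hn⟩
    refine ⟨n + 1, fun i hi => ?_⟩
    obtain ⟨i, rfl⟩ := Nat.exists_eq_add_of_le hi
    have := hn (n + i) (by omega)
    rwa [add_right_comm] at this

section Flat

variable {S : Type u} [CommRing S] {T : Type u} [CommRing T] [Algebra S T] [IsNoetherianRing S]
  [Module.FaithfullyFlat S T]

theorem ExtVanish.of_faithfullyFlat (M : Type u) [AddCommGroup M] [Module S M] [Module.Finite S M]
    (hM : ExtVanish T (T ⊗[S] M)) : ExtVanish S M := by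
  refine ExtVanish.of_class (fun M _ _ => Module.Finite S M ∧ ExtVanish T (T ⊗[S] M))
    (fun M _ _ hM => ?_) M ⟨‹_›, hM⟩
  obtain ⟨hfin, hM⟩ := hM
  obtain ⟨r, p, hp⟩ := exists_free_cover S M
  have hs := isShortExact_ker_subtype hp
  have hsT := hs.baseChange (T := T) .of_flat
  have hfinK : Module.Finite S (LinearMap.ker p) := hs.finite_left
  refine ⟨.of S (LinearMap.ker p), .of S (Fin r → S), _, p, inferInstanceAs
    (Module.Projective S (Fin r → S)), hs, ⟨hfinK, .left hsT .of_projective hM⟩, ?_⟩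
  suffices Function.Surjective (Module.Dual.transpose (R := S) (LinearMap.ker p).subtype) by
    intro φ
    obtain ⟨ψ, hψ⟩ := this φ
    exact ⟨ψ, fun k => congr($hψ k)⟩
  rw [← Module.FaithfullyFlat.lTensor_surjective_iff_surjective S T]
  intro z
  obtain ⟨ψ, hψ⟩ := hM.exists_extend hsT (dualBaseChange T _ z)
  obtain ⟨w, rfl⟩ := (dualBaseChange_bijective_of_flat (S := S) T (A := Fin r → S)).2 ψ
  refine ⟨w, (dualBaseChange_bijective_of_flat (S := S) T).1 ?_⟩
  exact (dualBaseChange_transpose T _ w).trans (LinearMap.ext hψ)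

theorem IsTotallyReflexive.of_faithfullyFlat (G : Type u) [AddCommGroup G] [Module S G]
    [Module.Finite S G] (hG : IsTotallyReflexive T (T ⊗[S] G)) : IsTotallyReflexive S G where
  finite := inferInstance
  ext_eq_zero := ExtVanish.of_faithfullyFlat G hG.extVanish
  ext_dual_eq_zero := by
    refine ExtVanish.of_faithfullyFlat (S := S) (T := T) (Module.Dual S G) ?_
    exact hG.extVanish_dual.of_equiv
      (LinearEquiv.ofBijective _ (dualBaseChange_bijective_of_flat (S := S) T (A := G)))
  bijective_dual_eval := by
    rw [← Module.FaithfullyFlat.lTensor_bijective_iff_bijective S T]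
    have h1 := dualBaseChange_bijective_of_flat (S := S) T (A := Module.Dual S G)
    have h2 : Function.Bijective (Module.Dual.transpose (R := T) (dualBaseChange (S := S) T G)) :=
      (LinearEquiv.ofBijective _
        (dualBaseChange_bijective_of_flat (S := S) T (A := G))).dualMap.bijective
    have h3 : (dualBaseChange (S := S) T (Module.Dual S G)).comp
        ((Module.Dual.eval S G).baseChange T) =
        (Module.Dual.transpose (R := T) (dualBaseChange (S := S) T G)).comp
          (Module.Dual.eval T (T ⊗[S] G)) := by
      ext v g
      simp [dualBaseChange_tmul, Module.Dual.transpose_apply]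
    have h4 := h2.comp hG.bijective_dual_eval
    refine (Function.Bijective.of_comp_iff' h1 _).1 ?_
    have h5 := congrArg DFunLike.coe h3
    rw [LinearMap.coe_comp, LinearMap.coe_comp] at h5
    exact h5 ▸ h4

/-- The property (TG) descends along faithfully flat maps. -/
theorem HasTG.of_faithfullyFlat (S T : Type u) [CommRing S] [CommRing T] [Algebra S T]
    [IsNoetherianRing S] [IsNoetherianRing T] [Module.FaithfullyFlat S T] (hT : HasTG T) :
    HasTG S := by
  rw [hasTG_iff] at hT ⊢
  intro M _ _ hfin hM
  obtain ⟨n, hn⟩ := hT (T ⊗[S] M) inferInstance (by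
    rw [hasBoundedSelfTor_iff] at hM ⊢
    obtain ⟨n, hn⟩ := hM
    exact ⟨n, fun i hi => (hn i hi).baseChange_of_flat⟩)
  exact ⟨n, .of_baseChange (fun G _ _ _ _ hG => .of_faithfullyFlat G hG) hfin .of_flat hn⟩

end Flat

/-! ### Lifting total reflexivity from the quotient by a regular element -/

namespace IsQuotientBy

variable {S : Type u} [CommRing S] {T : Type u} [CommRing T] [Algebra S T] {x : S}
  (h : IsQuotientBy S T x) {A B M : Type u} [AddCommGroup A] [Module S A]
  [AddCommGroup B] [Module S B] [AddCommGroup M] [Module S M]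

include h

theorem isShortExact_smul (hM : ∀ m : M, x • m = 0 → m = 0) :
    IsShortExact (x • LinearMap.id : M →ₗ[S] M) (TensorProduct.mk S T M 1) where
  inj := by
    rw [injective_iff_map_eq_zero]
    exact hM
  exact := h.one_tmul_eq_zero_iff
  surj := h.exists_one_tmul

/-- Maps to `S` extend along `f` if they do so modulo an element of the Jacobson radical. -/
theorem exists_extend [IsNoetherianRing S] (hx : x ∈ Ideal.jacobson (⊥ : Ideal S))
    [Module.Finite S A] [Module.Projective S B] (f : A →ₗ[S] B)
    (hf : ∀ φ : T ⊗[S] A →ₗ[T] T, ∃ ψ : T ⊗[S] B →ₗ[T] T, ∀ a, ψ (f.baseChange T a) = φ a)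
    (φ : A →ₗ[S] S) : ∃ ψ : B →ₗ[S] S, ∀ a, ψ (f a) = φ a := by
  suffices ⊤ ≤ LinearMap.range (Module.Dual.transpose (R := S) f) by
    obtain ⟨ψ, hψ⟩ := this (Submodule.mem_top (x := φ))
    exact ⟨ψ, fun a => congr($hψ a)⟩
  refine Submodule.le_of_le_smul_of_le_jacobson_bot Module.Finite.fg_top
    ((Ideal.span_singleton_le_iff_mem _).2 hx) fun g _ => ?_
  obtain ⟨ψ, hψ⟩ := hf (dualBaseChange T A (1 ⊗ₜ g))
  obtain ⟨k, hk⟩ := Module.projective_lifting_property (Algebra.linearMap S T)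
    ((ψ.restrictScalars S).comp (TensorProduct.mk S T B 1)) h.surj
  obtain ⟨g', hg'⟩ := h.exists_smul_eq (g - k.comp f) fun a => by
    have h1 := hψ (1 ⊗ₜ a)
    have h2 : algebraMap S T (k (f a)) = ψ (1 ⊗ₜ f a) := congr($hk (f a))
    rw [LinearMap.baseChange_tmul, dualBaseChange_one_tmul] at h1
    rw [LinearMap.sub_apply, map_sub, ← h1, sub_eq_zero, ← h2]
    rfl
  have hg : g = k.comp f + x • g' := by
    ext a
    rw [LinearMap.add_apply, LinearMap.smul_apply, smul_eq_mul, ← hg' a]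
    simp
  rw [hg]
  exact Submodule.add_mem_sup ⟨k, rfl⟩
    (Submodule.smul_mem_smul (Ideal.mem_span_singleton_self x) Submodule.mem_top)

theorem extVanish [IsNoetherianRing S] (hx : x ∈ Ideal.jacobson (⊥ : Ideal S))
    [Module.Finite S M] (hM : TorIndependent S T M) (hMT : ExtVanish T (T ⊗[S] M)) :
    ExtVanish S M := by
  refine ExtVanish.of_class (fun M _ _ => Module.Finite S M ∧ TorIndependent S T M ∧
    ExtVanish T (T ⊗[S] M)) (fun M _ _ hM => ?_) M ⟨‹_›, hM, hMT⟩
  obtain ⟨hfin, hM, hMT⟩ := hM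
  obtain ⟨r, p, hp⟩ := exists_free_cover S M
  have hs := isShortExact_ker_subtype hp
  have hsT := hs.baseChange (T := T) hM
  have hfinK : Module.Finite S (LinearMap.ker p) := hs.finite_left
  refine ⟨.of S (LinearMap.ker p), .of S (Fin r → S), _, p, inferInstanceAs
    (Module.Projective S (Fin r → S)), hs, ⟨hfinK, hM.left hs, .left hsT .of_projective hMT⟩, ?_⟩
  exact h.exists_extend hx _ (hMT.exists_extend hsT)

/-- If `Ext^1_S(M, S) = 0` then each map `T ⊗ M → T` is the reduction of a map `M → S`. -/
theorem exists_lift_dual (hM : ExtVanish S M) (φ : Module.Dual T (T ⊗[S] M)) :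
    ∃ g : Module.Dual S M, dualBaseChange T M (1 ⊗ₜ g) = φ := by
  obtain ⟨g, hg⟩ := hM.exists_lift h.isShortExact
    ((φ.restrictScalars S).comp (TensorProduct.mk S T M 1))
  refine ⟨g, LinearMap.ext fun z => ?_⟩
  obtain ⟨m, rfl⟩ := h.exists_one_tmul z
  rw [dualBaseChange_one_tmul]
  exact hg m

theorem dual_smul_eq_zero {g : Module.Dual S M} (hg : x • g = 0) : g = 0 := by
  ext m
  exact h.regular _ congr($hg m)

theorem dualBaseChange_bijective (hM : ExtVanish S M) :
    Function.Bijective (dualBaseChange (S := S) T M) := by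
  constructor
  · rw [injective_iff_map_eq_zero]
    intro z hz
    obtain ⟨g, rfl⟩ := h.exists_one_tmul z
    obtain ⟨g', hg'⟩ := h.exists_smul_eq g fun m => by
      rw [← dualBaseChange_one_tmul, hz, LinearMap.zero_apply]
    exact (h.one_tmul_eq_zero_iff g).2 ⟨g', LinearMap.ext fun m => (hg' m).symm⟩
  · intro φ
    obtain ⟨g, hg⟩ := h.exists_lift_dual hM φ
    exact ⟨_, hg⟩

theorem isTotallyReflexive [IsNoetherianRing S] (hx : x ∈ Ideal.jacobson (⊥ : Ideal S))
    [Module.Finite S M] (hM : TorIndependent S T M) (hMT : IsTotallyReflexive T (T ⊗[S] M)) :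
    IsTotallyReflexive S M := by
  have hext : ExtVanish S M := h.extVanish hx hM hMT.extVanish
  have hbij := h.dualBaseChange_bijective hext
  have hIx : Ideal.span {x} ≤ Ideal.jacobson (⊥ : Ideal S) :=
    (Ideal.span_singleton_le_iff_mem _).2 hx
  refine ⟨inferInstance, ⟨?_, ?_⟩, hext, ?_⟩
  · rw [← LinearMap.ker_eq_bot]
    refine Submodule.eq_bot_of_le_smul_of_le_jacobson_bot _ _ (IsNoetherian.noetherian _)
      (fun m hm => ?_) hIx
    have hm' : (1 : T) ⊗ₜ[S] m = 0 := by
      refine hMT.eq_of_forall fun φ => ?_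
      obtain ⟨g, rfl⟩ := h.exists_lift_dual hext φ
      have : g m = 0 := congr($(LinearMap.mem_ker.1 hm) g)
      rw [dualBaseChange_one_tmul, this, map_zero, map_zero]
    obtain ⟨v, rfl⟩ := (h.one_tmul_eq_zero_iff m).1 hm'
    refine Submodule.smul_mem_smul (Ideal.mem_span_singleton_self x) ?_
    rw [LinearMap.mem_ker, map_smul] at hm
    exact LinearMap.mem_ker.2 (h.dual_smul_eq_zero hm)
  · rw [← LinearMap.range_eq_top, eq_top_iff]
    refine Submodule.le_of_le_smul_of_le_jacobson_bot Module.Finite.fg_top hIx fun Λ _ => ?_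
    obtain ⟨z, hz⟩ := hMT.exists_eq_eval
      ((dualBaseChange T (Module.Dual S M) (1 ⊗ₜ Λ)).comp
        (LinearEquiv.ofBijective _ hbij).symm.toLinearMap)
    obtain ⟨m, rfl⟩ := h.exists_one_tmul z
    obtain ⟨Λ', hΛ'⟩ := h.exists_smul_eq (Λ - Module.Dual.eval S M m) fun g => by
      have h1 := hz (LinearEquiv.ofBijective _ hbij (1 ⊗ₜ g))
      rw [LinearMap.comp_apply, LinearEquiv.coe_coe, LinearEquiv.symm_apply_apply,
        dualBaseChange_one_tmul, LinearEquiv.ofBijective_apply, dualBaseChange_one_tmul] at h1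
      rw [LinearMap.sub_apply, map_sub, h1, Module.Dual.eval_apply, sub_self]
    have hΛ : Λ = Module.Dual.eval S M m + x • Λ' := by
      ext g
      rw [LinearMap.add_apply, LinearMap.smul_apply, smul_eq_mul, ← hΛ' g]
      simp
    rw [hΛ]
    exact Submodule.add_mem_sup ⟨m, rfl⟩
      (Submodule.smul_mem_smul (Ideal.mem_span_singleton_self x) Submodule.mem_top)
  · refine h.extVanish (M := Module.Dual S M) hx (h.torIndependent fun g => h.dual_smul_eq_zero) ?_
    exact hMT.extVanish_dual.of_equiv (LinearEquiv.ofBijective _ hbij)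

end IsQuotientBy

theorem HasBoundedSelfTor.left {R : Type u} [CommRing R] {A B C : Type u} [AddCommGroup A]
    [Module R A] [AddCommGroup B] [Module R B] [AddCommGroup C] [Module R C]
    [Module.Projective R B] {f : A →ₗ[R] B} {g : B →ₗ[R] C} (h : IsShortExact f g)
    (hC : HasBoundedSelfTor R C) : HasBoundedSelfTor R A := by
  rw [hasBoundedSelfTor_iff] at hC ⊢
  obtain ⟨n, hn⟩ := hC
  refine ⟨n, fun i hi => ?_⟩
  rw [← torZero_succ_succ_iff_left h, ← torZero_succ_succ_iff_right h]
  exact hn (i + 2) (by omega)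

/-- The property (TG) lifts from the quotient of a noetherian ring by a regular element in the
Jacobson radical. The given module is replaced by its first syzygy, on which the element is
regular. -/
theorem HasTG.of_isQuotientBy {S T : Type u} [CommRing S] [CommRing T] [Algebra S T]
    [IsNoetherianRing S] {x : S} (h : IsQuotientBy S T x)
    (hx : x ∈ Ideal.jacobson (⊥ : Ideal S)) (hT : HasTG T) : HasTG S := by
  have := h.isNoetherianRing
  rw [hasTG_iff] at hT ⊢
  intro M _ _ hfin hM
  obtain ⟨r, p, hp⟩ := exists_free_cover S M
  have hs := isShortExact_ker_subtype hp
  have hfinK : Module.Finite S (LinearMap.ker p) := hs.finite_left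
  have hK : HasBoundedSelfTor S (LinearMap.ker p) := hM.left hs
  have hreg : ∀ k : LinearMap.ker p, x • k = 0 → k = 0 := by
    intro k hk
    ext i
    exact h.regular _ (congr_fun congr(($hk : Fin r → S)) i)
  have hKT := h.torIndependent (M := LinearMap.ker p) hreg
  obtain ⟨n, hn⟩ := hT (T ⊗[S] LinearMap.ker p) inferInstance (by
    rw [hasBoundedSelfTor_iff] at hK ⊢
    obtain ⟨n, hn⟩ := hK
    refine ⟨n + 1, fun i hi => ?_⟩
    rw [torZero_baseChange_iff hKT]
    obtain ⟨i, rfl⟩ := Nat.exists_eq_add_of_le' hi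
    exact .right (h.isShortExact_smul (M := LinearMap.ker p) hreg) (hn (i + n) (by omega))
      (hn (i + n + 1) (by omega)))
  exact ⟨n + 1, .succ_of_isShortExact hs .of_projective <| .of_baseChange
    (fun G _ _ _ hG hGT => h.isTotallyReflexive hx hG hGT) hfinK hKT hn⟩

/-! ### Passing to the quotient by a regular element -/

namespace IsQuotientBy

variable {S : Type u} [CommRing S] {T : Type u} [CommRing T] [Algebra S T] {x : S}
  (h : IsQuotientBy S T x) {K G M : Type u} [AddCommGroup K] [Module S K]
  [AddCommGroup G] [Module S G] [AddCommGroup M] [Module T M] [Module S M] [IsScalarTower S T M]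

include h

/-- A `T`-module `M` is killed by `x`, so for `0 → K → G → M → 0` the multiplication by `x` on `G`
factors through `K`. -/
theorem exists_factor {i : K →ₗ[S] G} {p : G →ₗ[S] M} (hip : IsShortExact i p) :
    ∃ u : G →ₗ[S] K, ∀ v, i (u v) = x • v := by
  let e := LinearEquiv.ofInjective i hip.inj
  let q : G →ₗ[S] LinearMap.range i := (x • LinearMap.id : G →ₗ[S] G).codRestrict _ fun v =>
    hip.exists_eq (by simp [h.smul_eq_zero])
  refine ⟨e.symm.toLinearMap.comp q, fun v => ?_⟩
  exact congr((($(e.apply_symm_apply (q v)) : LinearMap.range i) : G))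

/-- If `0 → K → G → M → 0` is exact, where `M` is a `T`-module and `Ext^1_S(G, S) = 0`, then there
is an exact sequence `0 → G* → K* → Hom_T(M, T) → 0`: the module on the right is
`Ext^1_S(M, S)`. -/
theorem exists_dual_sequence {i : K →ₗ[S] G} {p : G →ₗ[S] M} (hip : IsShortExact i p)
    (hG : ExtVanish S G) {u : G →ₗ[S] K} (hu : ∀ v, i (u v) = x • v) :
    ∃ δ : Module.Dual S K →ₗ[S] Module.Dual T M,
      (∀ g v, δ g (p v) = algebraMap S T (g (u v))) ∧
        IsShortExact (Module.Dual.transpose (R := S) i) δ := by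
  have hui (k : K) : u (i k) = x • k := hip.inj (by rw [hu, map_smul])
  have key (g : Module.Dual S K) :
      ∃ ψ : Module.Dual T M, ∀ v, ψ (p v) = algebraMap S T (g (u v)) := by
    obtain ⟨ψ, hψ⟩ := hip.exists_desc ((Algebra.linearMap S T).comp (g.comp u)) fun k => by
      simp [hui, h.map_self]
    exact ⟨ψ.extendScalarsOfSurjective h.surj, hψ⟩
  choose δ hδ using key
  refine ⟨{ toFun := δ, map_add' := fun g g' => ?_, map_smul' := fun s g => ?_ }, hδ, ?_, ?_, ?_⟩
  · ext m
    obtain ⟨v, rfl⟩ := hip.surj m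
    rw [LinearMap.add_apply, hδ, hδ, hδ, LinearMap.add_apply, map_add]
  · ext m
    obtain ⟨v, rfl⟩ := hip.surj m
    rw [LinearMap.smul_apply, hδ, hδ, LinearMap.smul_apply, smul_eq_mul, map_mul, RingHom.id_apply,
      Algebra.smul_def]
  · rw [injective_iff_map_eq_zero]
    intro g hg
    ext v
    apply h.regular
    have : g (i (u v)) = 0 := congr($hg (u v))
    rw [← smul_eq_mul, ← map_smul, ← hu, this]
  · intro g
    constructor
    · intro hg
      obtain ⟨g', hg'⟩ := h.exists_smul_eq (g.comp u) fun v => by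
        rw [LinearMap.comp_apply, ← hδ]
        exact congr($hg (p v))
      refine ⟨g', LinearMap.ext fun k => ?_⟩
      have h1 := hg' (i k)
      rw [LinearMap.comp_apply, hui, map_smul, smul_eq_mul, ← sub_eq_zero, ← mul_sub] at h1
      exact (sub_eq_zero.1 (h.regular _ h1)).symm
    · rintro ⟨g, rfl⟩
      ext m
      obtain ⟨v, rfl⟩ := hip.surj m
      refine (hδ _ v).trans ?_
      rw [Module.Dual.transpose_apply, LinearMap.comp_apply, hu, map_smul, smul_eq_mul, map_mul,
        h.map_self, zero_mul, LinearMap.zero_apply]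
  · intro φ
    obtain ⟨g, hg⟩ := hG.exists_lift h.isShortExact ((φ.restrictScalars S).comp p)
    have hg (v : G) : algebraMap S T (g v) = φ (p v) := hg v
    obtain ⟨g', hg'⟩ := h.exists_smul_eq (g.comp i) fun k => by
      rw [LinearMap.comp_apply, hg, hip.map_eq_zero, map_zero]
    refine ⟨g', LinearMap.ext fun m => ?_⟩
    obtain ⟨v, rfl⟩ := hip.surj m
    refine (hδ g' v).trans ?_
    rw [← hg]
    congr 1
    have h1 := hg' (u v)
    rw [LinearMap.comp_apply, hu, map_smul, smul_eq_mul, ← sub_eq_zero, ← mul_sub] at h1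
    exact (sub_eq_zero.1 (h.regular _ h1)).symm

theorem isShortExact_pi (r : ℕ) :
    IsShortExact (x • LinearMap.id : (Fin r → S) →ₗ[S] (Fin r → S))
      ((Algebra.linearMap S T).compLeft (Fin r)) where
  inj := by
    rw [injective_iff_map_eq_zero]
    intro v hv
    ext j
    exact h.regular _ (congr_fun hv j)
  exact := by
    intro v
    constructor
    · intro hv
      choose w hw using fun j => (h.map_eq_zero_iff (v j)).1 (congr_fun hv j)
      exact ⟨w, funext hw⟩
    · rintro ⟨w, rfl⟩
      ext j
      exact (h.map_eq_zero_iff _).2 ⟨w j, rfl⟩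
  surj := by
    intro v
    choose w hw using fun j => h.surj (v j)
    exact ⟨w, funext hw⟩

/-- Let `K` be the kernel of a cover `S^r → T^r → M`. Then the first syzygy of `M` over `T` is the
quotient of `K` by the free module `x S^r`. -/
theorem exists_syzygy_sequence {r : ℕ} (q : (Fin r → T) →ₗ[T] M) :
    ∃ (j : (Fin r → S) →ₗ[S] LinearMap.ker ((q.restrictScalars S).comp
        ((Algebra.linearMap S T).compLeft (Fin r))))
      (π : LinearMap.ker ((q.restrictScalars S).comp
        ((Algebra.linearMap S T).compLeft (Fin r))) →ₗ[S] LinearMap.ker q),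
      (∀ v, (j v : Fin r → S) = x • v) ∧
      (∀ k, (π k : Fin r → T) = (Algebra.linearMap S T).compLeft (Fin r) k) ∧
      IsShortExact j π := by
  have hpi := h.isShortExact_pi r
  refine ⟨(x • LinearMap.id : (Fin r → S) →ₗ[S] (Fin r → S)).codRestrict _ fun v => ?_,
    { toFun := fun k => ⟨(Algebra.linearMap S T).compLeft (Fin r) k, k.2⟩
      map_add' := fun a b => Subtype.ext (map_add _ _ _)
      map_smul' := fun s a => Subtype.ext (map_smul _ _ _) },
    fun _ => rfl, fun _ => rfl, ?_, ?_, ?_⟩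
  · rw [LinearMap.mem_ker, LinearMap.comp_apply, hpi.map_eq_zero, map_zero]
  · intro a b hab
    exact hpi.inj congr(($hab : Fin r → S))
  · intro k
    refine Iff.trans Subtype.ext_iff ((hpi.exact k).trans ?_)
    exact ⟨fun ⟨v, hv⟩ => ⟨v, Subtype.ext hv⟩, fun ⟨v, hv⟩ => ⟨v, congrArg Subtype.val hv⟩⟩
  · rintro ⟨z, hz⟩
    obtain ⟨v, rfl⟩ := hpi.surj z
    exact ⟨⟨v, hz⟩, rfl⟩

theorem isShortExact_cover {r : ℕ} {q : (Fin r → T) →ₗ[T] M} (hq : Function.Surjective q) :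
    Function.Surjective ((q.restrictScalars S).comp ((Algebra.linearMap S T).compLeft (Fin r))) :=
  hq.comp (h.isShortExact_pi r).surj

/-- A finite G-dimension bound over `S` passes to the first syzygy over `T`. -/
theorem gDimLE_syzygy [IsNoetherianRing S] {r : ℕ} {q : (Fin r → T) →ₗ[T] M}
    (hq : Function.Surjective q) {n : ℕ} (hM : GDimLE S (n + 2) M) :
    GDimLE S (n + 1) (LinearMap.ker q) := by
  obtain ⟨j, π, -, -, hjπ⟩ := h.exists_syzygy_sequence q
  exact .right_of_projective hjπ (.of_cover (isShortExact_ker_subtype (h.isShortExact_cover hq)) hM)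

theorem exists_extend_syzygy [IsNoetherianRing S] {r : ℕ} {q : (Fin r → T) →ₗ[T] M}
    (hq : Function.Surjective q) (hM : GDimLE S 1 M) (φ : LinearMap.ker q →ₗ[T] T) :
    ∃ ψ : (Fin r → T) →ₗ[T] T, ∀ k : LinearMap.ker q, ψ k = φ k := by
  have hpi := h.isShortExact_pi r
  obtain ⟨j, π, hj, hπ, hjπ⟩ := h.exists_syzygy_sequence q
  have hK := gDimLE_zero.1 (hM.of_cover (isShortExact_ker_subtype (h.isShortExact_cover hq)))
  obtain ⟨g, hg⟩ := hK.extVanish.exists_lift h.isShortExact ((φ.restrictScalars S).comp π)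
  have hg k : algebraMap S T (g k) = φ (π k) := hg k
  obtain ⟨g', hg'⟩ := h.exists_smul_eq (g.comp j) fun v => by
    rw [LinearMap.comp_apply, hg, hjπ.map_eq_zero, map_zero]
  obtain ⟨ψ, hψ⟩ := hpi.exists_desc ((Algebra.linearMap S T).comp g') fun v => by
    simp [h.smul_eq_zero]
  refine ⟨ψ.extendScalarsOfSurjective h.surj, fun k => ?_⟩
  obtain ⟨k, rfl⟩ := hjπ.surj k
  rw [← hg, hπ]
  refine (hψ k).trans ?_
  -- `g'` extends `g` since `x g'(k) = g(x k) = x g(k)`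
  have h1 := hg' k
  have h2 : j (k : Fin r → S) = x • k := Subtype.ext (hj _)
  rw [LinearMap.comp_apply, h2, map_smul, smul_eq_mul, ← sub_eq_zero, ← mul_sub] at h1
  exact congrArg _ (sub_eq_zero.1 (h.regular _ h1)).symm

theorem extVanish_of_gDimLE_one [IsNoetherianRing S] [Module.Finite T M] (hM : GDimLE S 1 M) :
    ExtVanish T M := by
  have := h.isNoetherianRing
  refine ExtVanish.of_class (fun M _ _ => Module.Finite T M ∧
    ∃ (_ : Module S M) (_ : IsScalarTower S T M), GDimLE S 1 M) (fun M _ _ hM => ?_) M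
    ⟨‹_›, ‹_›, ‹_›, hM⟩
  obtain ⟨_, _, _, hM⟩ := hM
  obtain ⟨r, q, hq⟩ := exists_free_cover T M
  have hs := isShortExact_ker_subtype hq
  have : Module.Finite T (LinearMap.ker q) := hs.finite_left
  exact ⟨.of T (LinearMap.ker q), .of T (Fin r → T), _, q, inferInstanceAs
    (Module.Projective T (Fin r → T)), hs, ⟨this, inferInstance, inferInstance,
      h.gDimLE_syzygy hq hM.mono_succ⟩, h.exists_extend_syzygy hq hM⟩

/-- A `T`-module of G-dimension at most `1` over `S` is totally reflexive over `T`. -/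
theorem isTotallyReflexive_of_gDimLE_one [IsNoetherianRing S] [Module.Finite T M]
    (hM : GDimLE S 1 M) : IsTotallyReflexive T M := by
  have := h.isNoetherianRing
  have hext := h.extVanish_of_gDimLE_one hM
  obtain ⟨K, G, i, p, hG, hip, hK⟩ := hM
  have hK := gDimLE_zero.1 hK
  obtain ⟨u, hu⟩ := h.exists_factor hip
  obtain ⟨δ, hδ, hδe⟩ := h.exists_dual_sequence hip hG.extVanish hu
  have hui (k : K) : u (i k) = x • k := hip.inj (by rw [hu, map_smul])
  obtain ⟨δ', hδ', hδe'⟩ := h.exists_dual_sequence hδe hK.extVanish_dual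
    (u := Module.Dual.transpose (R := S) u) fun g => by
      ext k
      simp [Module.Dual.transpose_apply, hui]
  have hev (v : G) : δ' (Module.Dual.eval S G v) = Module.Dual.eval T M (p v) := by
    ext φ
    obtain ⟨g, rfl⟩ := hδe.surj φ
    rw [hδ', Module.Dual.eval_apply, Module.Dual.eval_apply, hδ]
    rfl
  refine ⟨‹_›, ⟨?_, ?_⟩, hext, ?_⟩
  · rw [injective_iff_map_eq_zero]
    intro m hm
    obtain ⟨v, rfl⟩ := hip.surj m
    rw [← hev] at hm
    obtain ⟨Λ, hΛ⟩ := hδe'.exists_eq hm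
    obtain ⟨k, hk⟩ := hK.exists_eq_eval Λ
    have : v = i k := by
      refine hG.eq_of_forall fun g => ?_
      have h1 : Λ (g.comp i) = g v := congr($hΛ g)
      rw [← h1, hk]
      rfl
    rw [this, hip.map_eq_zero]
  · intro Λ
    obtain ⟨Γ, rfl⟩ := hδe'.surj Λ
    obtain ⟨v, rfl⟩ := hG.bijective_dual_eval.2 Γ
    exact ⟨p v, (hev v).symm⟩
  · exact h.extVanish_of_gDimLE_one (M := Module.Dual T M)
      (.succ_of_isShortExact hδe hK.dual (gDimLE_zero.2 hG.dual))

theorem gDimLE [IsNoetherianRing S] : ∀ {n : ℕ} {M : Type u} [AddCommGroup M] [Module T M]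
    [Module S M] [IsScalarTower S T M], Module.Finite T M → GDimLE S (n + 1) M → GDimLE T n M
  | 0, _, _, _, _, _, _, hM => h.isTotallyReflexive_of_gDimLE_one hM
  | n + 1, M, _, _, _, _, _, hM => by
    have := h.isNoetherianRing
    obtain ⟨r, q, hq⟩ := exists_free_cover T M
    have hs := isShortExact_ker_subtype hq
    exact .succ_of_isShortExact hs .of_projective (gDimLE hs.finite_left (h.gDimLE_syzygy hq hM))

/-- For a free cover `0 → K → F → M → 0` over `S` of a `T`-module `M`, the sequence
`0 → M → T ⊗ K → T ⊗ F → M → 0` is exact; the module on the left is `Tor_1^S(T, M)`. -/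
theorem exists_four_term_sequence {i : K →ₗ[S] G} {p : G →ₗ[S] M} (hip : IsShortExact i p)
    (hG : ∀ v : G, x • v = 0 → v = 0) :
    ∃ (j : M →ₗ[T] T ⊗[S] K) (π : T ⊗[S] K →ₗ[T] LinearMap.ker (p.liftBaseChange T)),
      IsShortExact (C := LinearMap.ker (p.liftBaseChange T)) j π := by
  obtain ⟨u, hu⟩ := h.exists_factor hip
  have hui (k : K) : u (i k) = x • k := hip.inj (by rw [hu, map_smul])
  obtain ⟨j, hj⟩ := hip.exists_desc ((TensorProduct.mk S T K 1).comp u) fun k =>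
    (h.one_tmul_eq_zero_iff _).2 ⟨k, (hui k).symm⟩
  have hj (v : G) : j (p v) = 1 ⊗ₜ u v := hj v
  have hmem (z : T ⊗[S] K) : i.baseChange T z ∈ LinearMap.ker (p.liftBaseChange T) := by
    obtain ⟨k, rfl⟩ := h.exists_one_tmul z
    simp [hip.map_eq_zero]
  refine ⟨j.extendScalarsOfSurjective h.surj, (i.baseChange T).codRestrict _ hmem, ?_, ?_, ?_⟩
  · rw [injective_iff_map_eq_zero]
    intro m hm
    obtain ⟨v, rfl⟩ := hip.surj m
    obtain ⟨k, hk⟩ := (h.one_tmul_eq_zero_iff _).1 ((hj v).symm.trans hm)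
    have : v = i k := by
      rw [← sub_eq_zero]
      apply hG
      rw [smul_sub, ← map_smul, hk, hu, sub_self]
    rw [this, hip.map_eq_zero]
  · intro z
    obtain ⟨k, rfl⟩ := h.exists_one_tmul z
    refine Iff.trans Subtype.ext_iff ?_
    change (1 : T) ⊗ₜ[S] i k = 0 ↔ _
    rw [h.one_tmul_eq_zero_iff]
    constructor
    · rintro ⟨v, hv⟩
      refine ⟨p v, (hj v).trans ?_⟩
      rw [← hu] at hv
      rw [hip.inj hv]
    · rintro ⟨m, hm⟩
      obtain ⟨v, rfl⟩ := hip.surj m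
      have h1 : (1 : T) ⊗ₜ[S] (u v - k) = 0 := by
        rw [tmul_sub, sub_eq_zero, ← hj]
        exact hm
      obtain ⟨k', hk'⟩ := (h.one_tmul_eq_zero_iff _).1 h1
      refine ⟨v - i k', ?_⟩
      rw [smul_sub, ← map_smul, hk', map_sub, hu, sub_sub_cancel]
  · rintro ⟨z, hz⟩
    obtain ⟨v, rfl⟩ := h.exists_one_tmul z
    obtain ⟨k, rfl⟩ := hip.exists_eq (b := v) (by simpa using hz)
    exact ⟨1 ⊗ₜ k, Subtype.ext (by simp)⟩

theorem hasBoundedSelfTor (hM : HasBoundedSelfTor T M) : HasBoundedSelfTor S M := by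
  rw [hasBoundedSelfTor_iff] at hM ⊢
  obtain ⟨n, hn⟩ := hM
  have hs := isShortExact_ker_subtype (Finsupp.linearCombination_id_surjective S M)
  have hreg (v : M →₀ S) (hv : x • v = 0) : v = 0 := by
    ext m
    exact h.regular _ (DFunLike.congr_fun hv m)
  have hregK (k : LinearMap.ker (Finsupp.linearCombination S (id : M → M))) (hk : x • k = 0) :
      k = 0 := Subtype.ext (hreg _ congr(($hk : M →₀ S)))
  obtain ⟨j, π, hjπ⟩ := h.exists_four_term_sequence hs hreg
  have hs' : Function.Surjective
      ((Finsupp.linearCombination S (id : M → M)).liftBaseChange T) := fun m => by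
    obtain ⟨v, rfl⟩ := hs.surj m
    exact ⟨1 ⊗ₜ v, by simp⟩
  refine ⟨n + 1, fun i hi => ?_⟩
  obtain ⟨i, rfl⟩ := Nat.exists_eq_add_of_le' hi
  rw [← add_assoc, torZero_succ_succ_iff_right hs,
    ← torZero_baseChange_iff (h.torIndependent hregK), torZero_comm]
  refine .middle hjπ (hn _ (by omega)) ?_
  rw [← torZero_succ_succ_iff_left (isShortExact_ker_subtype hs')]
  exact hn _ (by omega)

end IsQuotientBy

/-- The property (TG) passes to the quotient of a noetherian ring by a regular element. -/
theorem HasTG.isQuotientBy {S T : Type u} [CommRing S] [CommRing T] [Algebra S T]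
    [IsNoetherianRing S] {x : S} (h : IsQuotientBy S T x) (hS : HasTG S) : HasTG T := by
  have := h.isNoetherianRing
  rw [hasTG_iff] at hS ⊢
  intro M _ _ hfin hM
  let _ : Module S M := Module.compHom M (algebraMap S T)
  have : IsScalarTower S T M := ⟨fun s t m => by
    rw [Algebra.smul_def, mul_smul]
    rfl⟩
  have : Module.Finite S T := Module.Finite.of_surjective (Algebra.linearMap S T) h.surj
  obtain ⟨n, hn⟩ := hS M (Module.Finite.trans T M) (h.hasBoundedSelfTor hM)
  exact ⟨n, h.gDimLE hfin hn.mono_succ⟩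

/-! ### Power series rings and localized polynomial rings -/

theorem HasTG.of_ringEquiv {S T : Type u} [CommRing S] [CommRing T] [IsNoetherianRing S]
    (e : S ≃+* T) (hT : HasTG T) : HasTG S := by
  let _ : Algebra S T := e.toRingHom.toAlgebra
  have : IsNoetherianRing T := isNoetherianRing_of_ringEquiv S e
  let l : T ≃ₗ[S] S :=
    { e.symm with
      map_smul' := fun s t => by
        change e.symm (e s * t) = s * e.symm t
        simp }
  have : Module.FaithfullyFlat S T := Module.FaithfullyFlat.of_linearEquiv _ _ l
  exact HasTG.of_faithfullyFlat S T hT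

/-- `B` is the quotient of `B⟦X⟧` by the regular element `X`. -/
theorem hasTG_powerSeries_iff (B : Type u) [CommRing B] [IsNoetherianRing B] :
    HasTG (PowerSeries B) ↔ HasTG B := by
  let _ : Algebra (PowerSeries B) B := (PowerSeries.constantCoeff (R := B)).toAlgebra
  have h : IsQuotientBy (PowerSeries B) B PowerSeries.X :=
    { surj := PowerSeries.constantCoeff_surj
      map_eq_zero_iff := fun s => by
        change PowerSeries.constantCoeff s = 0 ↔ _
        rw [← PowerSeries.X_dvd_iff]
        exact ⟨fun ⟨t, ht⟩ => ⟨t, ht.symm⟩, fun ⟨t, ht⟩ => ⟨t, ht.symm⟩⟩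
      regular := fun s hs => by
        ext n
        simpa using congr(PowerSeries.coeff (n + 1) $hs) }
  refine ⟨HasTG.isQuotientBy h, HasTG.of_isQuotientBy h ?_⟩
  rw [Ideal.mem_jacobson_bot]
  intro y
  rw [PowerSeries.isUnit_iff_constantCoeff]
  simp

theorem isNoetherianRing_mvPowerSeries (R : Type u) [CommRing R] [IsNoetherianRing R] (n : ℕ) :
    IsNoetherianRing (MvPowerSeries (Fin n) R) := by
  induction n with
  | zero =>
    exact isNoetherianRing_of_ringEquiv R (MvPowerSeries.isEmptyEquiv (Fin 0) R).symm.toRingEquiv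
  | succ n ih =>
    exact isNoetherianRing_of_ringEquiv _ (MvPowerSeries.finSuccEquiv R n).symm.toRingEquiv

theorem hasTG_mvPowerSeries_iff (R : Type u) [CommRing R] [IsNoetherianRing R] (n : ℕ) :
    HasTG (MvPowerSeries (Fin n) R) ↔ HasTG R := by
  have := isNoetherianRing_mvPowerSeries R
  induction n with
  | zero =>
    let e := (MvPowerSeries.isEmptyEquiv (Fin 0) R).toRingEquiv
    exact ⟨HasTG.of_ringEquiv e.symm, HasTG.of_ringEquiv e⟩
  | succ n ih =>
    let e := (MvPowerSeries.finSuccEquiv R n).toRingEquiv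
    refine Iff.trans ?_ ((hasTG_powerSeries_iff _).trans ih)
    exact ⟨HasTG.of_ringEquiv e.symm, HasTG.of_ringEquiv e⟩

section LocalizedPolynomialRing

variable (R : Type u) [CommRing R] [IsLocalRing R] (n : ℕ)

variable {R n} in
theorem mem_primeCompl_maxIdealX_iff (p : MvPolynomial (Fin n) R) :
    p ∈ (maxIdealX R n).primeCompl ↔ IsUnit (p : MvPowerSeries (Fin n) R) := by
  have h : p ∈ maxIdealX R n ↔ MvPolynomial.constantCoeff p ∈ IsLocalRing.maximalIdeal R := by
    rw [maxIdealX_eq_comap, Ideal.mem_comap]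
  rw [Ideal.mem_primeCompl_iff, h, IsLocalRing.notMem_maximalIdeal,
    MvPowerSeries.isUnit_iff_constantCoeff]
  simp [← MvPowerSeries.coeff_zero_eq_constantCoeff_apply, MvPolynomial.constantCoeff_eq]

/-- The inclusion of `R[X₁, …, Xₙ]` localized at `(𝔪, X₁, …, Xₙ)` into `R⟦X₁, …, Xₙ⟧`. -/
def localizedToPowerSeries :
    Localization.AtPrime (maxIdealX R n) →+* MvPowerSeries (Fin n) R :=
  IsLocalization.lift (M := (maxIdealX R n).primeCompl)
    (g := MvPolynomial.coeToMvPowerSeries.ringHom) fun p => (mem_primeCompl_maxIdealX_iff _).1 p.2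

theorem localizedToPowerSeries_algebraMap (p : MvPolynomial (Fin n) R) :
    localizedToPowerSeries R n (algebraMap _ _ p) = (p : MvPowerSeries (Fin n) R) :=
  IsLocalization.lift_eq (M := (maxIdealX R n).primeCompl) _ p

theorem isLocalHom_localizedToPowerSeries : IsLocalHom (localizedToPowerSeries R n) where
  map_nonunit a ha := by
    obtain ⟨p, s, rfl⟩ := IsLocalization.exists_mk'_eq (maxIdealX R n).primeCompl a
    have hp : IsUnit (p : MvPowerSeries (Fin n) R) := by
      rw [← localizedToPowerSeries_algebraMap, ← IsLocalization.mk'_spec _ p s, map_mul]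
      exact ha.mul ((IsLocalization.map_units _ s).map _)
    exact (IsLocalization.AtPrime.isUnit_mk'_iff _ (maxIdealX R n) p s).2
      ((mem_primeCompl_maxIdealX_iff p).2 hp)

variable [IsNoetherianRing R] {R n}

/-- `R⟦X₁, …, Xₙ⟧` is the completion of the polynomial ring in `(X₁, …, Xₙ)`, hence flat over it
and over its localization. -/
theorem HasTG.localization_of_mvPowerSeries (h : HasTG (MvPowerSeries (Fin n) R)) :
    HasTG (Localization.AtPrime (maxIdealX R n)) := by
  let P := MvPolynomial (Fin n) R
  let L := Localization.AtPrime (maxIdealX R n)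
  let _ : Algebra L (MvPowerSeries (Fin n) R) := (localizedToPowerSeries R n).toAlgebra
  have : IsScalarTower P L (MvPowerSeries (Fin n) R) :=
    IsScalarTower.of_algebraMap_eq fun p => (localizedToPowerSeries_algebraMap R n p).symm
  have : Module.Flat P (MvPowerSeries (Fin n) R) :=
    Module.Flat.of_linearEquiv (MvPowerSeries.toAdicCompletionAlgEquiv (Fin n) R).toLinearEquiv
  have : Module.Flat L (MvPowerSeries (Fin n) R) :=
    (Module.flat_iff_of_isLocalization L (maxIdealX R n).primeCompl _).2 this
  have : IsLocalHom (algebraMap L (MvPowerSeries (Fin n) R)) :=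
    isLocalHom_localizedToPowerSeries R n
  have : Module.FaithfullyFlat L (MvPowerSeries (Fin n) R) :=
    Module.FaithfullyFlat.of_flat_of_isLocalHom
  have := isNoetherianRing_mvPowerSeries R n
  exact HasTG.of_faithfullyFlat L _ h

theorem HasTG.of_localization (h : HasTG (Localization.AtPrime (maxIdealX R n))) : HasTG R := by
  let L := Localization.AtPrime (maxIdealX R n)
  have : IsLocalHom (algebraMap R L) :=
    { map_nonunit := fun r hr => by
        -- the constant term gives a retraction of the inclusion of `R`
        have := (hr.map (localizedToPowerSeries R n)).map MvPowerSeries.constantCoeff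
        rw [IsScalarTower.algebraMap_apply R (MvPolynomial (Fin n) R) L,
          localizedToPowerSeries_algebraMap] at this
        simpa [MvPolynomial.algebraMap_eq] using this }
  have : Module.FaithfullyFlat R L := Module.FaithfullyFlat.of_flat_of_isLocalHom
  exact HasTG.of_faithfullyFlat R L h

end LocalizedPolynomialRing

/-! ### Completion by adjoining the values of power series -/

section Relation

variable {B : Type u} [CommRing B] {a t : B} {h : PowerSeries B}

theorem coeff_eq_of_sub_mul_eq_C (e : (PowerSeries.X - PowerSeries.C a) * h = PowerSeries.C t)
    (i n : ℕ) : PowerSeries.coeff i h = a ^ n * PowerSeries.coeff (i + n) h := by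
  induction n with
  | zero => simp
  | succ n ih =>
    have := congr(PowerSeries.coeff (i + n + 1) $e)
    rw [sub_mul, map_sub, PowerSeries.coeff_succ_X_mul, PowerSeries.coeff_C_mul,
      PowerSeries.coeff_C, if_neg (by omega), sub_eq_zero] at this
    rw [ih, this, pow_succ, mul_assoc, add_assoc]

/-- Modulo `X - a` with `a` nilpotent, no constant becomes zero. -/
theorem eq_zero_of_sub_mul_eq_C (e : (PowerSeries.X - PowerSeries.C a) * h = PowerSeries.C t)
    {k : ℕ} (ha : a ^ k = 0) : t = 0 := by
  have h0 := coeff_eq_of_sub_mul_eq_C e 0 k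
  rw [ha, zero_mul] at h0
  have := congr(PowerSeries.coeff 0 $e)
  rw [sub_mul, map_sub, PowerSeries.coeff_zero_X_mul, PowerSeries.coeff_C_mul, h0] at this
  simpa using this.symm

/-- `X - a` is regular on `B⟦X⟧` by Krull's intersection theorem: all coefficients of a power
series killed by it are divisible by every power of `a`. -/
theorem eq_zero_of_sub_mul_eq_zero [IsNoetherianRing B] [IsLocalRing B]
    (ha : a ∈ IsLocalRing.maximalIdeal B) (e : (PowerSeries.X - PowerSeries.C a) * h = 0) :
    h = 0 := by
  ext i
  refine IsHausdorff.haus (I := IsLocalRing.maximalIdeal B) inferInstance _ fun n => ?_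
  rw [SModEq.zero, coeff_eq_of_sub_mul_eq_C (t := 0) (by simpa using e) i n, smul_eq_mul,
    Ideal.mul_top]
  exact Ideal.mul_mem_right _ _ (Ideal.pow_mem_pow ha n)

end Relation

/-- A presentation of a ring `T` as a quotient of `R⟦X₁, …, Xᵣ⟧` in which the variables become the
elements `a₁, …, aᵣ` of the maximal ideal of the local ring `R`, such that `T` agrees with `R`
modulo every power of the maximal ideal and inherits (TG) from `R`. -/
structure PowerSeriesQuotient (R : Type u) [CommRing R] [IsLocalRing R] {r : ℕ} (a : Fin r → R)
    (T : Type u) [CommRing T] where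
  /-- the presentation -/
  toFun : MvPowerSeries (Fin r) R →+* T
  surjective : Function.Surjective toFun
  map_X : ∀ i, toFun (MvPowerSeries.X i) = toFun (MvPowerSeries.C (a i))
  hasTG : HasTG R → HasTG T
  mem_of_map_mem : ∀ k c,
    toFun (MvPowerSeries.C c) ∈
      ((IsLocalRing.maximalIdeal R) ^ k).map (toFun.comp MvPowerSeries.C) →
    c ∈ IsLocalRing.maximalIdeal R ^ k
  exists_sub_mem : ∀ t, ∃ c, t - toFun (MvPowerSeries.C c) ∈
    (IsLocalRing.maximalIdeal R).map (toFun.comp MvPowerSeries.C)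

namespace PowerSeriesQuotient

variable {R : Type u} [CommRing R] [IsLocalRing R]

theorem nontrivial {r : ℕ} {a : Fin r → R} {T : Type u} [CommRing T]
    (Q : PowerSeriesQuotient R a T) : Nontrivial T := by
  by_contra hT
  rw [not_nontrivial_iff_subsingleton] at hT
  refine (Ideal.ne_top_iff_one _).1 (IsLocalRing.maximalIdeal.isMaximal R).ne_top ?_
  simpa using Q.mem_of_map_mem 1 1 (by
    rw [Subsingleton.elim (Q.toFun (MvPowerSeries.C 1)) 0]
    exact zero_mem _)

theorem isNoetherianRing {r : ℕ} {a : Fin r → R} {T : Type u} [CommRing T]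
    [IsNoetherianRing R] (Q : PowerSeriesQuotient R a T) : IsNoetherianRing T :=
  have := isNoetherianRing_mvPowerSeries R r
  isNoetherianRing_of_surjective _ _ Q.toFun Q.surjective

theorem isLocalRing {r : ℕ} {a : Fin r → R} {T : Type u} [CommRing T]
    (Q : PowerSeriesQuotient R a T) : IsLocalRing T :=
  have := Q.nontrivial
  .of_surjective' Q.toFun Q.surjective

theorem map_mem_maximalIdeal {r : ℕ} {a : Fin r → R} {T : Type u} [CommRing T] [IsLocalRing T]
    (Q : PowerSeriesQuotient R a T) {c : R} (hc : c ∈ IsLocalRing.maximalIdeal R) :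
    Q.toFun (MvPowerSeries.C c) ∈ IsLocalRing.maximalIdeal T := by
  have := Q.surjective.isLocalHom Q.toFun
  rw [IsLocalRing.mem_maximalIdeal, mem_nonunits_iff, isUnit_map_iff,
    MvPowerSeries.isUnit_iff_constantCoeff]
  simpa using hc

variable (R) in
/-- The trivial presentation of `R`, without variables. -/
def refl (a : Fin 0 → R) : PowerSeriesQuotient R a R := by
  let f := (MvPowerSeries.isEmptyEquiv (R := R) (Fin 0)).toRingEquiv.toRingHom
  have hf : ∀ c, f (MvPowerSeries.C c) = c := fun c =>
    (MvPowerSeries.isEmptyEquiv (R := R) (Fin 0)).commutes c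
  have hf' : f.comp MvPowerSeries.C = RingHom.id R := RingHom.ext hf
  exact
    { toFun := f
      surjective := (MvPowerSeries.isEmptyEquiv (R := R) (Fin 0)).surjective
      map_X := fun i => i.elim0
      hasTG := id
      mem_of_map_mem := fun k c hc => by
        rwa [hf, hf', Ideal.map_id] at hc
      exists_sub_mem := fun t => ⟨t, by simp [hf]⟩ }

section Step

variable {r : ℕ} {a : Fin (r + 1) → R} {T : Type u} [CommRing T]
  (Q : PowerSeriesQuotient R (fun i => a i.succ) T)

/-- The next ring `T⟦X⟧ ⧸ (X - a)`. -/
abbrev Next (Q : PowerSeriesQuotient R (fun i => a i.succ) T) : Type u :=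
  PowerSeries T ⧸ Ideal.span {PowerSeries.X - PowerSeries.C (Q.toFun (MvPowerSeries.C (a 0)))}

theorem isQuotientBy_next [IsNoetherianRing R] (ha : a 0 ∈ IsLocalRing.maximalIdeal R) :
    IsQuotientBy (PowerSeries T) Q.Next
      (PowerSeries.X - PowerSeries.C (Q.toFun (MvPowerSeries.C (a 0)))) where
  surj := Ideal.Quotient.mk_surjective
  map_eq_zero_iff s := by
    rw [Ideal.Quotient.algebraMap_eq, Ideal.Quotient.eq_zero_iff_mem, Ideal.mem_span_singleton]
    exact ⟨fun ⟨t, ht⟩ => ⟨t, ht.symm⟩, fun ⟨t, ht⟩ => ⟨t, ht.symm⟩⟩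
  regular s hs := by
    have := Q.isNoetherianRing
    have := Q.isLocalRing
    exact eq_zero_of_sub_mul_eq_zero (Q.map_mem_maximalIdeal ha) hs

/-- The presentation of the next ring. -/
def nextHom : MvPowerSeries (Fin (r + 1)) R →+* Q.Next :=
  (Ideal.Quotient.mk _).comp ((PowerSeries.map Q.toFun).comp
    (MvPowerSeries.finSuccEquiv R r).toRingEquiv.toRingHom)

theorem nextHom_C (c : R) : Q.nextHom (MvPowerSeries.C c) =
    Ideal.Quotient.mk _ (PowerSeries.C (Q.toFun (MvPowerSeries.C c))) := by
  simp [nextHom]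

theorem nextHom_X (i : Fin (r + 1)) :
    Q.nextHom (MvPowerSeries.X i) = Q.nextHom (MvPowerSeries.C (a i)) := by
  rw [nextHom_C]
  induction i using Fin.cases with
  | zero =>
    simp only [nextHom, RingHom.comp_apply]
    rw [Ideal.Quotient.eq]
    simp
  | succ i => simp [nextHom, Q.map_X]

theorem map_comp_nextHom (J : Ideal R) : J.map (Q.nextHom.comp MvPowerSeries.C) =
    ((J.map (Q.toFun.comp MvPowerSeries.C)).map (PowerSeries.C (R := T))).map
      (Ideal.Quotient.mk _) := by
  rw [Ideal.map_map, Ideal.map_map]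
  congr 1
  ext c
  simp [nextHom_C]

theorem nextHom_mem_of_map_mem (ha : a 0 ∈ IsLocalRing.maximalIdeal R) (k : ℕ) (c : R)
    (hc : Q.nextHom (MvPowerSeries.C c) ∈
      ((IsLocalRing.maximalIdeal R) ^ k).map (Q.nextHom.comp MvPowerSeries.C)) :
    c ∈ IsLocalRing.maximalIdeal R ^ k := by
  refine Q.mem_of_map_mem k c ?_
  set J := ((IsLocalRing.maximalIdeal R) ^ k).map (Q.toFun.comp MvPowerSeries.C)
  rw [map_comp_nextHom, nextHom_C, Ideal.mem_quotient_iff_mem_sup, Submodule.mem_sup] at hc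
  obtain ⟨u, hu, v, hv, e⟩ := hc
  obtain ⟨h, rfl⟩ := Ideal.mem_span_singleton.1 hv
  -- reduce the coefficients modulo `J`, where `a` becomes nilpotent
  have hu' : PowerSeries.map (Ideal.Quotient.mk J) u = 0 := by
    have : J.map (PowerSeries.C (R := T)) ≤
        RingHom.ker (PowerSeries.map (Ideal.Quotient.mk J)) := by
      rw [Ideal.map_le_iff_le_comap]
      intro j hj
      rw [Ideal.mem_comap, RingHom.mem_ker, PowerSeries.map_C, Ideal.Quotient.eq_zero_iff_mem.2 hj,
        map_zero]
    exact this hu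
  have e' := congr(PowerSeries.map (Ideal.Quotient.mk J) $e)
  rw [map_add, hu', zero_add, map_mul, map_sub, PowerSeries.map_X, PowerSeries.map_C,
    PowerSeries.map_C] at e'
  rw [← Ideal.Quotient.eq_zero_iff_mem]
  refine eq_zero_of_sub_mul_eq_C e' (k := k) ?_
  rw [← map_pow, Ideal.Quotient.eq_zero_iff_mem, ← map_pow, ← map_pow]
  exact Ideal.mem_map_of_mem (Q.toFun.comp MvPowerSeries.C) (Ideal.pow_mem_pow ha k)

/-- The presentation of `T⟦X⟧ ⧸ (X - a)` that extends a presentation of `T`. -/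
def next [IsNoetherianRing R] (ha : a 0 ∈ IsLocalRing.maximalIdeal R) :
    PowerSeriesQuotient R a Q.Next where
  toFun := Q.nextHom
  surjective := Ideal.Quotient.mk_surjective.comp
    ((PowerSeries.map_surjective _ Q.surjective).comp (MvPowerSeries.finSuccEquiv R r).surjective)
  map_X := Q.nextHom_X
  hasTG hR := by
    have := Q.isNoetherianRing
    exact HasTG.isQuotientBy (Q.isQuotientBy_next ha) ((hasTG_powerSeries_iff T).2 (Q.hasTG hR))
  mem_of_map_mem := Q.nextHom_mem_of_map_mem ha
  exists_sub_mem t := by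
    obtain ⟨g, rfl⟩ := Ideal.Quotient.mk_surjective t
    obtain ⟨c, hc⟩ := Q.exists_sub_mem (PowerSeries.constantCoeff g)
    refine ⟨c, ?_⟩
    rw [nextHom_C, ← map_sub, PowerSeries.eq_X_mul_shift_add_const g, add_sub_assoc, ← map_sub,
      map_add, map_mul]
    refine add_mem (Ideal.mul_mem_right _ _ ?_) ?_
    · have : Ideal.Quotient.mk _ (PowerSeries.X : PowerSeries T) =
          Q.nextHom (MvPowerSeries.C (a 0)) := by
        rw [← nextHom_X]
        simp [nextHom]
      rw [this]
      exact Ideal.mem_map_of_mem (Q.nextHom.comp MvPowerSeries.C) ha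
    · rw [map_comp_nextHom]
      exact Ideal.mem_map_of_mem _ (Ideal.mem_map_of_mem _ hc)

end Step

theorem exists_powerSeriesQuotient [IsNoetherianRing R] {r : ℕ} (a : Fin r → R)
    (ha : ∀ i, a i ∈ IsLocalRing.maximalIdeal R) :
    ∃ (T : Type u) (_ : CommRing T), Nonempty (PowerSeriesQuotient R a T) := by
  induction r with
  | zero => exact ⟨R, inferInstance, ⟨refl R a⟩⟩
  | succ r ih =>
    obtain ⟨T, _, ⟨Q⟩⟩ := ih (fun i => a i.succ) fun i => ha i.succ
    exact ⟨Q.Next, inferInstance, ⟨Q.next (ha 0)⟩⟩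

section Completion

variable {r : ℕ} {a : Fin r → R} {T : Type u} [CommRing T] (Q : PowerSeriesQuotient R a T)

/-- The structure map `R → T`. -/
def ofBase : R →+* T := Q.toFun.comp MvPowerSeries.C

theorem exists_sub_mem_pow (t : T) (k : ℕ) :
    ∃ c, t - Q.ofBase c ∈ ((IsLocalRing.maximalIdeal R).map Q.ofBase) ^ k := by
  have key : ∀ k, ∀ s ∈ ((IsLocalRing.maximalIdeal R) ^ k).map Q.ofBase,
      ∃ c ∈ (IsLocalRing.maximalIdeal R) ^ k,
        s - Q.ofBase c ∈ ((IsLocalRing.maximalIdeal R) ^ (k + 1)).map Q.ofBase := by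
    intro k s hs
    induction hs using Submodule.span_induction with
    | mem s hs =>
      obtain ⟨c, hc, rfl⟩ := hs
      exact ⟨c, hc, by simp⟩
    | zero => exact ⟨0, zero_mem _, by simp⟩
    | add s s' _ _ hs hs' =>
      obtain ⟨c, hc, h⟩ := hs
      obtain ⟨c', hc', h'⟩ := hs'
      refine ⟨c + c', add_mem hc hc', ?_⟩
      rw [map_add, add_sub_add_comm]
      exact add_mem h h'
    | smul t s _ hs =>
      obtain ⟨c, hc, h⟩ := hs
      obtain ⟨d, hd⟩ := Q.exists_sub_mem t
      refine ⟨d * c, Ideal.mul_mem_left _ _ hc, ?_⟩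
      have : t • s - Q.ofBase (d * c) =
          t * (s - Q.ofBase c) + Q.ofBase c * (t - Q.ofBase d) := by
        rw [smul_eq_mul, map_mul]
        ring
      rw [this]
      refine add_mem (Ideal.mul_mem_left _ _ h) ?_
      rw [pow_succ, Ideal.map_mul]
      exact Ideal.mul_mem_mul (Ideal.mem_map_of_mem _ hc) hd
  induction k with
  | zero => exact ⟨0, by simp⟩
  | succ k ih =>
    obtain ⟨c, hc⟩ := ih
    rw [← Ideal.map_pow] at hc ⊢
    obtain ⟨d, -, hd⟩ := key k _ hc
    exact ⟨c + d, by rwa [map_add, ← sub_sub]⟩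

theorem ofBase_mem_pow_iff {k : ℕ} {c : R} :
    Q.ofBase c ∈ ((IsLocalRing.maximalIdeal R).map Q.ofBase) ^ k ↔
      c ∈ IsLocalRing.maximalIdeal R ^ k := by
  rw [← Ideal.map_pow]
  exact ⟨Q.mem_of_map_mem k c, Ideal.mem_map_of_mem _⟩

/-- Completeness passes from `R⟦X₁, …, Xᵣ⟧` to its quotient `T`. -/
theorem isAdicComplete [IsNoetherianRing R]
    (ha : Ideal.span (Set.range a) = IsLocalRing.maximalIdeal R) :
    IsAdicComplete ((IsLocalRing.maximalIdeal R).map Q.ofBase) T := by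
  have := Q.isNoetherianRing
  have := Q.isLocalRing
  refine
    { toIsHausdorff := IsHausdorff.of_isLocalRing _ _ ?_
      toIsPrecomplete := ?_ }
  · refine ne_top_of_le_ne_top (IsLocalRing.maximalIdeal.isMaximal T).ne_top ?_
    rw [Ideal.map_le_iff_le_comap]
    exact fun c hc => Q.map_mem_maximalIdeal hc
  · let P := MvPowerSeries (Fin r) R
    let _ : Algebra P T := Q.toFun.toAlgebra
    let V : Ideal P := Ideal.span (Set.range MvPowerSeries.X)
    have hV : V.map (algebraMap P T) = (IsLocalRing.maximalIdeal R).map Q.ofBase := by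
      rw [← ha, Ideal.map_span, Ideal.map_span, ← Set.range_comp, ← Set.range_comp]
      congr 2
      ext i
      exact Q.map_X i
    rw [← hV, IsPrecomplete.map_algebraMap_iff, ← AdicCompletion.of_surjective_iff]
    intro y
    obtain ⟨x, rfl⟩ := AdicCompletion.map_surjective V (f := Algebra.linearMap P T) Q.surjective y
    obtain ⟨p, rfl⟩ := AdicCompletion.of_surjective V P x
    exact ⟨algebraMap P T p, by rw [AdicCompletion.map_of]; rfl⟩

include Q in
/-- A complete ring that agrees with `R` modulo the powers of the maximal ideal is the
completion of `R`. -/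
theorem nonempty_ringEquiv [IsNoetherianRing R]
    (ha : Ideal.span (Set.range a) = IsLocalRing.maximalIdeal R) :
    Nonempty (AdicCompletion (IsLocalRing.maximalIdeal R) R ≃+* T) := by
  have := Q.isAdicComplete ha
  set m := IsLocalRing.maximalIdeal R
  set n := m.map Q.ofBase
  have hcomap : ∀ k, m ^ k = (n ^ k).comap Q.ofBase := fun k => by
    ext c
    exact Q.ofBase_mem_pow_iff.symm
  let f : ∀ k, AdicCompletion m R →+* T ⧸ n ^ k := fun k =>
    (Ideal.quotientMap (n ^ k) Q.ofBase (hcomap k).le).comp (AdicCompletion.evalₐ m k).toRingHom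
  have hf_mk : ∀ k s, f k (AdicCompletion.mk m R s) = Ideal.Quotient.mk _ (Q.ofBase (s k)) :=
    fun k s => by simp [f]
  have hf : ∀ {j k : ℕ} (hle : j ≤ k), (Ideal.Quotient.factorPow n hle).comp (f k) = f j := by
    intro j k hle
    ext x
    induction x using AdicCompletion.induction_on with
    | _ s =>
      rw [RingHom.comp_apply, hf_mk, hf_mk]
      change Ideal.Quotient.mk _ _ = _
      rw [Ideal.Quotient.eq, ← map_sub, Q.ofBase_mem_pow_iff]
      have := (s.2 hle).symm
      rwa [SModEq.sub_mem, smul_eq_mul, Ideal.mul_top] at this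
  let F := IsAdicComplete.liftRingHom n f hf
  have hF : ∀ k x, Ideal.Quotient.mk (n ^ k) (F x) = f k x :=
    IsAdicComplete.mk_liftRingHom n f hf
  refine ⟨RingEquiv.ofBijective F ⟨?_, fun t => ?_⟩⟩
  · rw [injective_iff_map_eq_zero]
    intro x hx
    refine AdicCompletion.ext_evalₐ fun k => ?_
    have h := hF k x
    rw [hx, map_zero] at h
    rw [map_zero]
    refine (injective_iff_map_eq_zero _).1
      (Ideal.quotientMap_injective' (H := (hcomap k).le) (hcomap k).ge) _ h.symm
  · choose c hc using Q.exists_sub_mem_pow t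
    let s : AdicCompletion.AdicCauchySequence m R := AdicCompletion.AdicCauchySequence.mk m R c (by
      intro k
      rw [SModEq.sub_mem, smul_eq_mul, Ideal.mul_top, ← Q.ofBase_mem_pow_iff, map_sub]
      have := sub_mem (Ideal.pow_le_pow_right k.le_succ (hc (k + 1))) (hc k)
      rwa [sub_sub_sub_cancel_left] at this)
    refine ⟨AdicCompletion.mk m R s, ?_⟩
    rw [IsHausdorff.eq_iff_smodEq (I := n)]
    intro k
    rw [SModEq.sub_mem, smul_eq_mul, Ideal.mul_top, ← Ideal.Quotient.eq, hF, hf_mk,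
      Ideal.Quotient.eq, ← neg_sub, neg_mem_iff]
    exact hc k

end Completion

end PowerSeriesQuotient

theorem hasTG_adicCompletion_iff (R : Type u) [CommRing R] [IsNoetherianRing R] [IsLocalRing R] :
    HasTG (AdicCompletion (IsLocalRing.maximalIdeal R) R) ↔ HasTG R := by
  obtain ⟨r, a, ha⟩ :=
    Submodule.fg_iff_exists_fin_generating_family.1
      (IsNoetherian.noetherian (IsLocalRing.maximalIdeal R))
  obtain ⟨T, _, ⟨Q⟩⟩ := PowerSeriesQuotient.exists_powerSeriesQuotient a
    fun i => ha.le (Submodule.subset_span ⟨i, rfl⟩)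
  obtain ⟨e⟩ := Q.nonempty_ringEquiv ha
  have := Q.isNoetherianRing
  have : IsNoetherianRing (AdicCompletion (IsLocalRing.maximalIdeal R) R) :=
    isNoetherianRing_of_ringEquiv T e.symm
  refine ⟨fun h => ?_, fun h => HasTG.of_ringEquiv e (Q.hasTG h)⟩
  have : Module.FaithfullyFlat R (AdicCompletion (IsLocalRing.maximalIdeal R) R) :=
    Module.FaithfullyFlat.of_flat_of_isLocalHom
  exact HasTG.of_faithfullyFlat R _ h

end TorGDim

end

theorem theorem3p2 {R : Type u} [CommRing R] [IsNoetherianRing R] [IsLocalRing R] (n : ℕ) :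
    List.TFAE [
      TorGDim.HasTG R,
      TorGDim.HasTG (AdicCompletion (IsLocalRing.maximalIdeal R) R),
      TorGDim.HasTG (MvPowerSeries (Fin n) R),
      TorGDim.HasTG (Localization.AtPrime (TorGDim.maxIdealX R n))] := by
  tfae_have 2 ↔ 1 := TorGDim.hasTG_adicCompletion_iff R
  tfae_have 3 ↔ 1 := TorGDim.hasTG_mvPowerSeries_iff R n
  tfae_have 3 → 4 := TorGDim.HasTG.localization_of_mvPowerSeries
  tfae_have 4 → 1 := TorGDim.HasTG.of_localization
  tfae_finish
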